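/- For positive integers $l_1,\dots,l_n$ with $l_1\ge 2$ let $$\zeta(l_1,\dots,l_n)=\sum_{m_1>m_2>\cdots>m_n>0}\frac{1}{m_1^{l_1}m_2^{l_2}\cdots m_n^{l_n}}$$ (a convergent series); for $n=1$ this is the value $\zeta(l_1)$ of the Riemann zeta function. Let $l\ge 5$ be an integer, and let $\sum'$ denote the sum over all positive integers $l_1,l_2,l_3,l_4$ with $l_1\ge 2$ and $l_1+l_2+l_3+l_4=l$. Then the following hold. (i) $$\sum{}'\left(2^{l_1+l_2+l_3-2}+2^{l_1+l_2-2}+2^{l_1-1}-2^{l_2+l_3-1}-2^{l_2-1}\right)\zeta(l_1,l_2,l_3,l_4)=l\,\zeta(l),$$ $$\sum{}'\left(2^{l_1+l_2+l_3-1}+2^{l_1+l_2-1}-2^{l_2+l_3}-2^{l_2}-2^{l_3+1}\right)\zeta(l_1,l_2,l_3,l_4)=(l-3)\,\zeta(l),$$ $$\sum{}'\left(2^{l_1}+2^{l_3+1}\right)\zeta(l_1,l_2,l_3,l_4)=(l+3)\,\zeta(l).$$ (ii) $$\sum{}'\left(3^{l_2}2^{l_1-1}-3^{l_2}-1\right)2^{l_1+l_3}\,\zeta(l_1,l_2,l_3,l_4)=\frac{(l+1)(l^2+5l-18)}{12}\,\zeta(l).$$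 -/

import Mathlib

/-- The index set of the series defining a multiple zeta value of depth `n`:
tuples of integers `m₁ > m₂ > ⋯ > mₙ > 0`. -/
abbrev MZVIndex (n : ℕ) : Type :=
  {m : Fin n → ℕ // StrictAnti m ∧ ∀ i, 0 < m i}

/-- The general term `1 / (m₁ ^ s₁ * ⋯ * mₙ ^ sₙ)` of the series. -/
noncomputable def mzvTerm {n : ℕ} (s : Fin n → ℕ) (m : MZVIndex n) : ℝ :=
  1 / ∏ i, (m.1 i : ℝ) ^ s i

/-- The multiple zeta value `ζ(s₁, …, sₙ)`, the sum of `1 / (m₁ ^ s₁ * ⋯ * mₙ ^ sₙ)` over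
`m₁ > ⋯ > mₙ > 0`. -/
noncomputable def multipleZeta {n : ℕ} (s : Fin n → ℕ) : ℝ :=
  ∑' m : MZVIndex n, mzvTerm s m

/-- All quadruples `(k₁, k₂, k₃, k₄)` of positive integers with `k₁ ≥ 2` and
`k₁ + k₂ + k₃ + k₄ = l`; the component `kⱼ` is `k (j - 1)`. -/
def quadIndices (l : ℕ) : Finset (Fin 4 → ℕ) :=
  (Finset.Nat.antidiagonalTuple 4 l).filter fun k => 2 ≤ k 0 ∧ ∀ i, 1 ≤ k i

/-! All weights are collected in truncated generating functions: `truncGen [c₁, …, cₙ] N` is the sum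
of ∏ X/(mᵢ - cᵢX) over N ≥ m₁ > ⋯ > mₙ > 0. Its coefficient of X^l is the sum of ∏ cᵢ^(kᵢ-1) times
truncated zeta values of weight l (`coeff_truncGen`), and the weights in the theorem are of this
shape.

Products are computed in two ways. The stuffle product (`cumul_mul_cumul`) is exact for each N, and
partial fractions (`letter_mul_letter`) simplify its diagonal terms. The shuffle product
(`genSeries_mul_genSeries`) adds variables: [1,1] times itself yields [2,2,2,1] and [2,2,1,1], and
[2,1] times itself yields copies of [4,3,2,1].

The shuffle truncates to i + j ≤ N, the stuffle to i, j ≤ N. Once the same product with one leading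
variable set to 0 is subtracted, the two agree up to O((log N)^k / N) in every coefficient
(`decays_shuffle`), so the computation takes place modulo `negligible`. The same subtraction removes
the divergent terms k₁ = 1, leaving `genDiff`. Suitable linear combinations of these relations
cancel everything but the wanted depth-four classes and depth-one sums of powers of a letter. In
degree l ≥ 5 the powers of `letter 0` vanish and `letter 1 ^ (j + 1)` gives C(l-1, j) ζ(l), hence
the polynomials in l. -/

open PowerSeries

/-! ### Sequences bounded by powers of log N over powers of N -/

/-- One plus the `N`-th harmonic number. -/
noncomputable def harmBound (N : ℕ) : ℝ := 1 + ∑ m ∈ Finset.range N, 1 / ((m : ℝ) + 1)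

lemma one_le_harmBound (N : ℕ) : 1 ≤ harmBound N := by
  unfold harmBound
  have : 0 ≤ ∑ m ∈ Finset.range N, 1 / ((m : ℝ) + 1) := Finset.sum_nonneg fun _ _ => by positivity
  linarith

lemma harmBound_pos (N : ℕ) : 0 < harmBound N := lt_of_lt_of_le one_pos (one_le_harmBound N)

lemma harmBound_mono : Monotone harmBound := by
  refine monotone_nat_of_le_succ fun n => ?_
  unfold harmBound
  rw [Finset.sum_range_succ]
  have : 0 ≤ 1 / ((n : ℝ) + 1) := by positivity
  linarith

lemma harmBound_pow_le {j k : ℕ} (h : j ≤ k) (N : ℕ) : harmBound N ^ j ≤ harmBound N ^ k :=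
  pow_le_pow_right₀ (one_le_harmBound N) h

lemma harmBound_pow_le_of_le {m N : ℕ} (h : m ≤ N) (k : ℕ) : harmBound m ^ k ≤ harmBound N ^ k :=
  pow_le_pow_left₀ (harmBound_pos m).le (harmBound_mono h) k

lemma tendsto_harmBound_pow_div (k : ℕ) :
    Filter.Tendsto (fun N : ℕ => harmBound N ^ k / ((N : ℝ) + 1)) Filter.atTop (nhds 0) := by
  have h1 : Filter.Tendsto (fun x : ℝ => Real.log x ^ k / x) Filter.atTop (nhds 0) := by
    simpa using (Real.isLittleO_pow_log_id_atTop (n := k)).tendsto_div_nhds_zero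
  have h2 : Filter.Tendsto (fun N : ℕ => (N : ℝ) + 3) Filter.atTop Filter.atTop :=
    Filter.tendsto_atTop_add_const_right _ _ tendsto_natCast_atTop_atTop
  have h3 : Filter.Tendsto (fun N : ℕ => (3 ^ (k + 1) : ℝ) *
      (Real.log ((N : ℝ) + 3) ^ k / ((N : ℝ) + 3))) Filter.atTop (nhds 0) := by
    simpa using (h1.comp h2).const_mul (3 ^ (k + 1) : ℝ)
  refine squeeze_zero (fun N => ?_) (fun N => ?_) h3
  · have := harmBound_pos N
    positivity
  -- The shift by 3 > e makes the logarithm at least 1, which absorbs the constant in 2 + log N ≤ 3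
  -- log (N + 3).
  · have hlog : 1 ≤ Real.log ((N : ℝ) + 3) := by
      rw [Real.le_log_iff_exp_le (by positivity)]
      have := Real.exp_one_lt_three
      have : (0 : ℝ) ≤ N := by positivity
      linarith
    have hb : harmBound N ≤ 3 * Real.log ((N : ℝ) + 3) := by
      have h4 : harmBound N = 1 + (harmonic N : ℝ) := by
        simp [harmBound, harmonic]
      have h5 := harmonic_le_one_add_log N
      have h6 : Real.log (N : ℝ) ≤ Real.log ((N : ℝ) + 3) := by
        rcases Nat.eq_zero_or_pos N with h | h
        · subst h
          simpa using Real.log_nonneg (by norm_num : (1 : ℝ) ≤ 3)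
        · exact Real.log_le_log (by exact_mod_cast h) (by linarith)
      rw [h4]
      linarith
    have h7 : harmBound N ^ k ≤ 3 ^ k * Real.log ((N : ℝ) + 3) ^ k := by
      rw [← mul_pow]
      exact pow_le_pow_left₀ (harmBound_pos N).le hb k
    have h8 : (N : ℝ) + 3 ≤ 3 * ((N : ℝ) + 1) := by
      have : (0 : ℝ) ≤ N := by positivity
      linarith
    rw [div_le_iff₀ (by positivity)]
    calc harmBound N ^ k ≤ 3 ^ k * Real.log ((N : ℝ) + 3) ^ k := h7
      _ = 3 ^ k * (Real.log ((N : ℝ) + 3) ^ k / ((N : ℝ) + 3)) * ((N : ℝ) + 3) := by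
          field_simp
      _ ≤ 3 ^ k * (Real.log ((N : ℝ) + 3) ^ k / ((N : ℝ) + 3)) * (3 * ((N : ℝ) + 1)) := by
          gcongr
      _ = _ := by ring

/-- The sequence `u` is `O((log N) ^ k / N ^ p)` for some `k`. -/
def DecaysBy (p : ℕ) (u : ℕ → ℝ) : Prop :=
  ∃ C : ℝ, ∃ k : ℕ, 0 ≤ C ∧ ∀ N, |u N| ≤ C * harmBound N ^ k / ((N : ℝ) + 1) ^ p

namespace DecaysBy

variable {p q : ℕ} {u v : ℕ → ℝ}

lemma zero : DecaysBy p fun _ => 0 := ⟨0, 0, le_rfl, fun N => by simp⟩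

lemma const (c : ℝ) : DecaysBy 0 fun _ => c := ⟨|c|, 0, abs_nonneg c, fun N => by simp⟩

lemma add (hu : DecaysBy p u) (hv : DecaysBy p v) : DecaysBy p fun N => u N + v N := by
  obtain ⟨C, k, hC, h⟩ := hu
  obtain ⟨D, j, hD, h'⟩ := hv
  refine ⟨C + D, k + j, by positivity, fun N => (abs_add_le _ _).trans ((add_le_add (h N) (h' N)).trans ?_)⟩
  have h1 := harmBound_pow_le (Nat.le_add_right k j) N
  have h2 := harmBound_pow_le (Nat.le_add_left j k) N
  rw [add_mul, add_div]
  gcongr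

lemma mul (hu : DecaysBy p u) (hv : DecaysBy q v) : DecaysBy (p + q) fun N => u N * v N := by
  obtain ⟨C, k, hC, h⟩ := hu
  obtain ⟨D, j, hD, h'⟩ := hv
  refine ⟨C * D, k + j, by positivity, fun N => ?_⟩
  rw [abs_mul]
  have h3 := harmBound_pos N
  calc |u N| * |v N| ≤ (C * harmBound N ^ k / ((N : ℝ) + 1) ^ p) *
        (D * harmBound N ^ j / ((N : ℝ) + 1) ^ q) :=
        mul_le_mul (h N) (h' N) (abs_nonneg _) (by positivity)
    _ = _ := by rw [div_mul_div_comm, ← pow_add]; ring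

lemma mono (hu : DecaysBy p u) (hqp : q ≤ p) : DecaysBy q u := by
  obtain ⟨C, k, hC, h⟩ := hu
  refine ⟨C, k, hC, fun N => (h N).trans ?_⟩
  have h3 := harmBound_pos N
  have h4 : (1 : ℝ) ≤ (N : ℝ) + 1 := by simp
  gcongr

lemma const_mul (c : ℝ) (hu : DecaysBy p u) : DecaysBy p fun N => c * u N := by
  simpa using (const c).mul hu

lemma finsetSum {ι : Type*} (s : Finset ι) {u : ι → ℕ → ℝ} (h : ∀ i ∈ s, DecaysBy p (u i)) :
    DecaysBy p fun N => ∑ i ∈ s, u i N := by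
  have h' := Finset.sum_induction u (DecaysBy p) (fun _ _ => add) zero h
  convert h' using 1
  funext N
  simp

lemma cumulativeSum (hu : DecaysBy 1 u) : DecaysBy 0 fun N => ∑ m ∈ Finset.range N, u m := by
  obtain ⟨C, k, hC, h⟩ := hu
  refine ⟨C, k + 1, hC, fun N => (Finset.abs_sum_le_sum_abs _ _).trans ?_⟩
  have h1 : ∀ m ∈ Finset.range N, |u m| ≤ C * harmBound N ^ k * (1 / ((m : ℝ) + 1)) := by
    intro m hm
    have h2 := harmBound_mono (Finset.mem_range.mp hm).le
    have h3 := harmBound_pos m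
    refine (h m).trans ?_
    rw [pow_one, mul_one_div]
    gcongr
  refine (Finset.sum_le_sum h1).trans ?_
  rw [← Finset.mul_sum, pow_zero, div_one, pow_succ, ← mul_assoc]
  have h4 := harmBound_pos N
  gcongr
  unfold harmBound
  linarith

lemma tendsto_zero (hu : DecaysBy 1 u) : Filter.Tendsto u Filter.atTop (nhds 0) := by
  obtain ⟨C, k, hC, h⟩ := hu
  refine squeeze_zero_norm (fun N => h N) ?_
  simpa [mul_div_assoc] using (tendsto_harmBound_pow_div k).const_mul C

/-- The part of a double series outside the triangle `i + j ≤ N`. -/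
lemma convolutionTail (hu : DecaysBy 1 u) (hv : DecaysBy 2 v) :
    DecaysBy 1 fun N => ∑ i ∈ Finset.range N, ∑ j ∈ Finset.range N,
      if N < i + j + 2 then u i * v j else 0 := by
  obtain ⟨C, k, hC, h⟩ := hu
  obtain ⟨D, j, hD, h'⟩ := hv
  refine ⟨2 * (C * D), k + j + 2, by positivity, fun N => ?_⟩
  have hpos := harmBound_pos N
  set B := C * D * harmBound N ^ (k + j) / ((N : ℝ) + 1) with hB
  have hB0 : 0 ≤ B := by positivity
  -- With i = a + 1 and j = b + 1, outside the triangle 1 ≤ (i + j)/(N + 1), so 1/(i j²) ≤ (1/(i j)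
  -- + 1/j²)/(N + 1).
  have hterm : ∀ a ∈ Finset.range N, ∀ b ∈ Finset.range N,
      |if N < a + b + 2 then u a * v b else 0| ≤
        B * (1 / ((a : ℝ) + 1) * (1 / ((b : ℝ) + 1))) +
        (if N < a + b + 2 then B * (1 / ((b : ℝ) + 1) ^ 2) else 0) := by
    intro a ha b hb
    split_ifs with hab
    · have h1 := harmBound_pow_le_of_le (Finset.mem_range.mp ha).le k
      have h2 := harmBound_pow_le_of_le (Finset.mem_range.mp hb).le j
      have ha0 := harmBound_pos a
      have hb0 := harmBound_pos b
      have h3 : |u a * v b| ≤ (C * harmBound N ^ k / ((a : ℝ) + 1)) *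
          (D * harmBound N ^ j / ((b : ℝ) + 1) ^ 2) := by
        rw [abs_mul]
        refine mul_le_mul ((h a).trans ?_) ((h' b).trans ?_) (abs_nonneg _) (by positivity)
        · rw [pow_one]; gcongr
        · gcongr
      refine h3.trans ?_
      have hab' : (N : ℝ) + 1 ≤ (a : ℝ) + 1 + ((b : ℝ) + 1) := by
        have : ((N + 1 : ℕ) : ℝ) ≤ ((a + b + 2 : ℕ) : ℝ) := by exact_mod_cast hab
        push_cast at this
        linarith
      have e1 : (C * harmBound N ^ k / ((a : ℝ) + 1)) * (D * harmBound N ^ j / ((b : ℝ) + 1) ^ 2)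
          = C * D * harmBound N ^ (k + j) * (1 / (((a : ℝ) + 1) * ((b : ℝ) + 1) ^ 2)) := by
        rw [pow_add]; field_simp
      have e2 : B * (1 / ((a : ℝ) + 1) * (1 / ((b : ℝ) + 1))) + B * (1 / ((b : ℝ) + 1) ^ 2)
          = C * D * harmBound N ^ (k + j) * (((a : ℝ) + 1 + ((b : ℝ) + 1)) / ((N : ℝ) + 1) *
            (1 / (((a : ℝ) + 1) * ((b : ℝ) + 1) ^ 2))) := by
        rw [hB]; field_simp; ring
      rw [e1, e2]
      have h5 : 1 ≤ ((a : ℝ) + 1 + ((b : ℝ) + 1)) / ((N : ℝ) + 1) := by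
        rw [one_le_div (by positivity)]; exact hab'
      refine mul_le_mul_of_nonneg_left ?_ (by positivity)
      exact le_mul_of_one_le_left (by positivity) h5
    · rw [abs_zero, add_zero]
      positivity
  have hsum : ∑ m ∈ Finset.range N, 1 / ((m : ℝ) + 1) ≤ harmBound N := by
    unfold harmBound; linarith
  have hsum0 : 0 ≤ ∑ m ∈ Finset.range N, 1 / ((m : ℝ) + 1) :=
    Finset.sum_nonneg fun _ _ => by positivity
  calc |∑ a ∈ Finset.range N, ∑ b ∈ Finset.range N, if N < a + b + 2 then u a * v b else 0|
      ≤ ∑ a ∈ Finset.range N, ∑ b ∈ Finset.range N,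
          |if N < a + b + 2 then u a * v b else 0| :=
        (Finset.abs_sum_le_sum_abs _ _).trans
          (Finset.sum_le_sum fun _ _ => Finset.abs_sum_le_sum_abs _ _)
    _ ≤ ∑ a ∈ Finset.range N, ∑ b ∈ Finset.range N,
          (B * (1 / ((a : ℝ) + 1) * (1 / ((b : ℝ) + 1))) +
            (if N < a + b + 2 then B * (1 / ((b : ℝ) + 1) ^ 2) else 0)) :=
        Finset.sum_le_sum fun a ha => Finset.sum_le_sum fun b hb => hterm a ha b hb
    _ = B * ((∑ m ∈ Finset.range N, 1 / ((m : ℝ) + 1)) * ∑ m ∈ Finset.range N, 1 / ((m : ℝ) + 1))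
        + ∑ b ∈ Finset.range N, ∑ a ∈ Finset.range N,
            (if N < a + b + 2 then B * (1 / ((b : ℝ) + 1) ^ 2) else 0) := by
        simp_rw [Finset.sum_add_distrib]
        rw [Finset.sum_mul_sum, Finset.mul_sum]
        congr 1
        · exact Finset.sum_congr rfl fun _ _ => by rw [Finset.mul_sum]
        · rw [Finset.sum_comm]
    _ ≤ B * (harmBound N * harmBound N) + ∑ b ∈ Finset.range N, B * (1 / ((b : ℝ) + 1)) := by
        refine add_le_add (mul_le_mul_of_nonneg_left
          (mul_le_mul hsum hsum hsum0 hpos.le) hB0) (Finset.sum_le_sum fun b hb => ?_)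
        rw [← Finset.sum_filter, Finset.sum_const, nsmul_eq_mul]
        -- Only j = b + 1 values of i can exceed N - j, so summing 1/j² over i costs one power of j
        -- and leaves a harmonic sum.
        have hcard : ((Finset.range N).filter fun a => N < a + b + 2).card ≤ b + 1 := by
          calc ((Finset.range N).filter fun a => N < a + b + 2).card
              ≤ (Finset.Ico (N - (b + 1)) N).card :=
                Finset.card_le_card fun a ha => by
                  simp only [Finset.mem_filter, Finset.mem_range, Finset.mem_Ico] at ha ⊢
                  omega
            _ ≤ b + 1 := by rw [Nat.card_Ico]; omega
        have hcard' : (((Finset.range N).filter fun a => N < a + b + 2).card : ℝ) ≤ (b : ℝ) + 1 := by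
          exact_mod_cast hcard
        calc _ ≤ ((b : ℝ) + 1) * (B * (1 / ((b : ℝ) + 1) ^ 2)) :=
              mul_le_mul_of_nonneg_right hcard' (by positivity)
          _ = _ := by field_simp
    _ ≤ B * (harmBound N * harmBound N) + B * (harmBound N * harmBound N) := by
        rw [← Finset.mul_sum]
        gcongr
        exact hsum.trans (le_mul_of_one_le_left hpos.le (one_le_harmBound N))
    _ = _ := by rw [hB, pow_one]; ring

end DecaysBy

/-! ### Nested sums and the stuffle product -/

/-- The sequence `N ↦ ∑_{1 ≤ m ≤ N} f m * U (m - 1)`. -/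
def cumul {R : Type*} [CommSemiring R] (f U : ℕ → R) : ℕ → R :=
  fun N => ∑ m ∈ Finset.range N, f (m + 1) * U m

section Cumul

variable {R : Type*} [CommRing R]

lemma cumul_zero (f U : ℕ → R) : cumul f U 0 = 0 := by simp [cumul]

lemma cumul_succ (f U : ℕ → R) (N : ℕ) : cumul f U (N + 1) = cumul f U N + f (N + 1) * U N := by
  simp [cumul, Finset.sum_range_succ]

lemma cumul_add (f U V : ℕ → R) : cumul f (U + V) = cumul f U + cumul f V := by
  funext N; simp [cumul, mul_add, Finset.sum_add_distrib]

lemma cumul_sub (f U V : ℕ → R) : cumul f (U - V) = cumul f U - cumul f V := by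
  funext N; simp [cumul, mul_sub, Finset.sum_sub_distrib]

lemma add_cumul (f g U : ℕ → R) : cumul (f + g) U = cumul f U + cumul g U := by
  funext N; simp [cumul, add_mul, Finset.sum_add_distrib]

lemma sub_cumul (f g U : ℕ → R) : cumul (f - g) U = cumul f U - cumul g U := by
  funext N; simp [cumul, sub_mul, Finset.sum_sub_distrib]

lemma cumul_smul {S : Type*} [CommRing S] [Algebra S R] (c : S) (f U : ℕ → R) :
    cumul f (c • U) = c • cumul f U := by
  funext N; simp [cumul, Finset.smul_sum]

lemma smul_cumul {S : Type*} [CommRing S] [Algebra S R] (c : S) (f U : ℕ → R) :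
    cumul (c • f) U = c • cumul f U := by
  funext N; simp [cumul, Finset.smul_sum]

/-- The quasi-shuffle (stuffle) product of two nested sums. -/
lemma cumul_mul_cumul (f g U V : ℕ → R) :
    cumul f U * cumul g V =
      cumul f (U * cumul g V) + cumul g (cumul f U * V) + cumul (f * g) (U * V) := by
  funext N
  simp only [Pi.mul_apply, Pi.add_apply]
  induction N with
  | zero => simp [cumul_zero]
  | succ N ih =>
    simp only [cumul_succ, Pi.mul_apply] at ih ⊢
    linear_combination ih

end Cumul

/-! ### Coefficientwise growth bounds -/

/-- A sequence of power series each of whose coefficients is `O((log N) ^ k / N ^ p)`. -/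
def CoeffDecaysBy (p : ℕ) (u : ℕ → ℝ⟦X⟧) : Prop :=
  ∀ d, DecaysBy p fun N => coeff d (u N)

namespace CoeffDecaysBy

variable {p q : ℕ} {u v : ℕ → ℝ⟦X⟧}

lemma zero : CoeffDecaysBy p 0 := fun d => by simpa using DecaysBy.zero

lemma const (c : ℝ⟦X⟧) : CoeffDecaysBy 0 fun _ => c := fun _ => DecaysBy.const _

lemma add (hu : CoeffDecaysBy p u) (hv : CoeffDecaysBy p v) : CoeffDecaysBy p (u + v) :=
  fun d => by simpa using (hu d).add (hv d)

lemma const_smul (c : ℝ) (hu : CoeffDecaysBy p u) : CoeffDecaysBy p (c • u) :=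
  fun d => by simpa using (hu d).const_mul c

lemma mul (hu : CoeffDecaysBy p u) (hv : CoeffDecaysBy q v) : CoeffDecaysBy (p + q) (u * v) := by
  intro d
  have h := DecaysBy.finsetSum (p := p + q) (Finset.HasAntidiagonal.antidiagonal d)
    (u := fun x N => coeff x.1 (u N) * coeff x.2 (v N))
    fun x _ => (hu x.1).mul (hv x.2)
  convert h using 1
  funext N
  simp [coeff_mul]

lemma mono (hu : CoeffDecaysBy p u) (h : q ≤ p) : CoeffDecaysBy q u := fun d => (hu d).mono h

lemma cumul {f : ℕ → ℝ⟦X⟧} (hf : CoeffDecaysBy 1 fun m => f (m + 1)) (hu : CoeffDecaysBy 0 u) :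
    CoeffDecaysBy 0 (cumul f u) := by
  intro d
  simpa [_root_.cumul] using ((hf.mul hu) d).cumulativeSum

lemma convolutionTail (hu : CoeffDecaysBy 1 u) (hv : CoeffDecaysBy 2 v) :
    CoeffDecaysBy 1 fun N => ∑ i ∈ Finset.range N, ∑ j ∈ Finset.range N,
      if N < i + j + 2 then u i * v j else 0 := by
  intro d
  have h := DecaysBy.finsetSum (p := 1) (Finset.HasAntidiagonal.antidiagonal d)
    (u := fun x N => ∑ i ∈ Finset.range N, ∑ j ∈ Finset.range N,
      if N < i + j + 2 then coeff x.1 (u i) * coeff x.2 (v j) else 0)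
    fun x _ => (hu x.1).convolutionTail (hv x.2)
  convert h using 1
  funext N
  rw [Finset.sum_comm, map_sum]
  refine Finset.sum_congr rfl fun i _ => ?_
  rw [Finset.sum_comm, map_sum]
  refine Finset.sum_congr rfl fun j _ => ?_
  split_ifs
  · rw [coeff_mul]
  · simp

end CoeffDecaysBy

/-! ### The letters X / (m - cX) and partial fractions -/

/-- The power series `X / (m - c X)`. -/
noncomputable def letter (c m : ℕ) : ℝ⟦X⟧ := X * mk fun d => (c : ℝ) ^ d / (m : ℝ) ^ (d + 1)

lemma coeff_zero_letter (c m : ℕ) : coeff 0 (letter c m) = 0 := by simp [letter]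

lemma coeff_succ_letter (c m d : ℕ) :
    coeff (d + 1) (letter c m) = (c : ℝ) ^ d / (m : ℝ) ^ (d + 1) := by
  simp [letter, coeff_succ_X_mul]

lemma letter_zero_right (c : ℕ) : letter c 0 = 0 := by
  ext d
  cases d <;> simp [coeff_zero_letter, coeff_succ_letter]

lemma sub_mul_letter (c : ℕ) {m : ℕ} (hm : m ≠ 0) :
    ((m : ℝ⟦X⟧) - (c : ℝ⟦X⟧) * X) * letter c m = X := by
  have hm' : (m : ℝ) ≠ 0 := by exact_mod_cast hm
  have h : ((m : ℝ⟦X⟧) - (c : ℝ⟦X⟧) * X) * mk (fun d => (c : ℝ) ^ d / (m : ℝ) ^ (d + 1)) = 1 := by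
    have e1 : (m : ℝ⟦X⟧) = C (m : ℝ) := by simp
    have e2 : (c : ℝ⟦X⟧) = C (c : ℝ) := by simp
    rw [e1, e2, sub_mul, mul_assoc]
    ext d
    rw [map_sub, coeff_C_mul, coeff_C_mul, coeff_mk]
    cases d with
    | zero => simp [hm']
    | succ d =>
      rw [coeff_succ_X_mul, coeff_mk, coeff_one, if_neg (Nat.succ_ne_zero d)]
      field_simp
      ring
  rw [letter, mul_left_comm, h, mul_one]

lemma natCast_sub_mul_X_ne_zero (c : ℕ) {m : ℕ} (hm : m ≠ 0) :
    (m : ℝ⟦X⟧) - (c : ℝ⟦X⟧) * X ≠ 0 := by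
  intro h
  have := sub_mul_letter c hm
  rw [h, zero_mul] at this
  exact X_ne_zero this.symm

/-- Partial fractions. -/
lemma letter_mul_letter (a b : ℕ) :
    ((a : ℝ) - b) • (letter a * letter b) = letter a - letter b := by
  funext m
  rcases eq_or_ne m 0 with rfl | hm
  · simp [letter_zero_right]
  · have ha := sub_mul_letter a hm
    have hb := sub_mul_letter b hm
    apply mul_left_cancel₀ (natCast_sub_mul_X_ne_zero a hm)
    apply mul_left_cancel₀ (natCast_sub_mul_X_ne_zero b hm)
    have e : ((a : ℝ) - b) • (letter a m * letter b m) =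
        ((a : ℝ⟦X⟧) - b) * (letter a m * letter b m) := by
      rw [smul_eq_C_mul]; simp
    simp only [Pi.smul_apply, Pi.mul_apply, Pi.sub_apply]
    rw [e]
    linear_combination (((a : ℝ⟦X⟧) - b) * ((m : ℝ⟦X⟧) - b * X) * letter b m - ((m : ℝ⟦X⟧) - b * X)) * ha
      + (((a : ℝ⟦X⟧) - b) * X + ((m : ℝ⟦X⟧) - a * X)) * hb

lemma decays_letter (c : ℕ) : CoeffDecaysBy 1 fun m => letter c (m + 1) := by
  intro d
  cases d with
  | zero => simpa [coeff_zero_letter] using DecaysBy.zero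
  | succ d =>
    refine ⟨(c : ℝ) ^ d, 0, by positivity, fun N => ?_⟩
    beta_reduce
    rw [coeff_succ_letter, abs_of_nonneg (by positivity), pow_zero, mul_one, pow_one]
    push_cast
    gcongr
    exact le_self_pow₀ (by simp) (Nat.succ_ne_zero d)

/-- The leading coefficient X/m does not depend on c, so it cancels and one more power of m is
gained. This is what makes the shuffle error negligible. -/
lemma decays_letter_sub (c : ℕ) :
    CoeffDecaysBy 2 fun m => letter c (m + 1) - letter 0 (m + 1) := by
  intro d
  match d with
  | 0 => simpa only [map_sub, coeff_zero_letter, sub_zero] using DecaysBy.zero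
  | 1 => simpa [coeff_succ_letter] using DecaysBy.zero
  | d + 2 =>
    refine ⟨(c : ℝ) ^ (d + 1), 0, by positivity, fun N => ?_⟩
    beta_reduce
    rw [map_sub, coeff_succ_letter, coeff_succ_letter, Nat.cast_zero, zero_pow (Nat.succ_ne_zero d),
      zero_div, sub_zero, abs_of_nonneg (by positivity), pow_zero, mul_one]
    push_cast
    gcongr
    · simp
    · omega

/-! ### Truncated generating functions and the shuffle product -/

/-- The generating function of the truncated multiple harmonic sums of a given depth, with the
variable `c X` attached to each entry `c` of the list. -/
noncomputable def truncGen : List ℕ → ℕ → ℝ⟦X⟧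
  | [] => 1
  | c :: w => cumul (letter c) (truncGen w)

lemma decays_truncGen (w : List ℕ) : CoeffDecaysBy 0 (truncGen w) := by
  induction w with
  | nil => exact CoeffDecaysBy.const 1
  | cons c w ih => exact (decays_letter c).cumul ih

/-- The increment `truncGen w n - truncGen w (n - 1)`. -/
noncomputable def genTerm : List ℕ → ℕ → ℝ⟦X⟧
  | [], n => if n = 0 then 1 else 0
  | c :: w, n => letter c n * truncGen w (n - 1)

lemma genTerm_cons_zero (c : ℕ) (w : List ℕ) : genTerm (c :: w) 0 = 0 := by
  simp [genTerm, letter_zero_right]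

lemma genTerm_cons_succ (c : ℕ) (w : List ℕ) (n : ℕ) :
    genTerm (c :: w) (n + 1) = letter c (n + 1) * truncGen w n := by
  simp [genTerm]

lemma sum_genTerm (w : List ℕ) (N : ℕ) : ∑ n ∈ Finset.range (N + 1), genTerm w n = truncGen w N := by
  cases w with
  | nil => simp [genTerm, truncGen]
  | cons c w =>
    rw [Finset.sum_range_succ', genTerm_cons_zero, add_zero]
    simp [genTerm_cons_succ, truncGen, cumul]

/-- The words occurring in the shuffle product; an entry of a word is the sum of the variables
attached to the letters from that position on. -/
def shuffleWords : List ℕ → List ℕ → List (List ℕ)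
  | [], v => [v]
  | a :: u, [] => [a :: u]
  | a :: u, b :: v =>
    (shuffleWords u (b :: v) ++ shuffleWords (a :: u) v).map (List.cons (a + b))
  termination_by u v => u.length + v.length

/-- The series `∑ₙ genTerm w n Tⁿ`. -/
noncomputable def genSeries (w : List ℕ) : ℝ⟦X⟧⟦X⟧ := mk (genTerm w)

lemma mk_truncGen (w : List ℕ) : mk (truncGen w) = genSeries w * mk 1 := by
  ext1 N
  rw [coeff_mk, coeff_mul, Finset.Nat.sum_antidiagonal_eq_sum_range_succ_mk]
  simp [genSeries, sum_genTerm]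

/-- Coefficient form of the differential equation (T d/dT - cX) G(c :: w) = X · T/(1 - T) · G(w),
where G is `genSeries` and `mk 1` is 1/(1 - T). -/
lemma sub_mul_genTerm_cons (c : ℕ) (w : List ℕ) (n : ℕ) :
    ((n : ℝ⟦X⟧) - (c : ℝ⟦X⟧) * X) * genTerm (c :: w) n =
      X * coeff n (X * (genSeries w * mk 1)) := by
  cases n with
  | zero => simp [genTerm_cons_zero]
  | succ n =>
    rw [genTerm_cons_succ, ← mul_assoc, sub_mul_letter c (Nat.succ_ne_zero n), coeff_succ_X_mul,
      ← mk_truncGen, coeff_mk]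

/-- By the Leibniz rule, T d/dT - (a + b)X applied to G(a :: u) G(b :: v) gives X · T/(1 - T) ·
(G(u) G(b :: v) + G(a :: u) G(v)). By induction the sum over shuffles satisfies the same equation.
For n ≠ 0 the factor n - (a + b)X can be cancelled; for n = 0 both coefficients vanish. -/
lemma genSeries_mul_genSeries (u v : List ℕ) :
    genSeries u * genSeries v = ((shuffleWords u v).map genSeries).sum := by
  have hnil : genSeries [] = 1 := by
    ext1 n
    simp [genSeries, genTerm, coeff_one]
  match u, v with
  | [], v => simp [shuffleWords, hnil]
  | a :: u, [] => simp [shuffleWords, hnil]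
  | a :: u, b :: v =>
    have ih1 := genSeries_mul_genSeries u (b :: v)
    have ih2 := genSeries_mul_genSeries (a :: u) v
    set W := shuffleWords u (b :: v) ++ shuffleWords (a :: u) v with hW
    have hsum : (W.map genSeries).sum = genSeries u * genSeries (b :: v) +
        genSeries (a :: u) * genSeries v := by
      rw [hW, List.map_append, List.sum_append, ih1, ih2]
    have hlin : ∀ (n : ℕ) (L : List (List ℕ)),
        ((n : ℝ⟦X⟧) - ((a + b : ℕ) : ℝ⟦X⟧) * X) *
          coeff n (((L.map (List.cons (a + b))).map genSeries).sum) =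
        X * coeff n (X * ((L.map genSeries).sum * mk 1)) := by
      intro n L
      induction L with
      | nil => simp
      | cons w L ih =>
        simp only [List.map_cons, List.sum_cons, map_add, mul_add, add_mul, ih]
        congr 1
        simpa [genSeries] using sub_mul_genTerm_cons (a + b) w n
    ext1 n
    rw [shuffleWords]
    rcases eq_or_ne n 0 with rfl | hn
    · rw [← hW]
      have : ∀ L : List (List ℕ), coeff 0 (((L.map (List.cons (a + b))).map genSeries).sum) = 0 := by
        intro L
        induction L with
        | nil => simp
        | cons w L ih =>
          simp only [List.map_cons, List.sum_cons, map_add, ih, add_zero]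
          simp only [genSeries, coeff_mk, genTerm_cons_zero]
      rw [this, coeff_mul]
      simp [genSeries, genTerm_cons_zero]
    · apply mul_left_cancel₀ (natCast_sub_mul_X_ne_zero (a + b) hn)
      rw [hlin, hsum]
      have key : ((n : ℝ⟦X⟧) - ((a + b : ℕ) : ℝ⟦X⟧) * X) *
          coeff n (genSeries (a :: u) * genSeries (b :: v)) =
          coeff n (mk (fun i => ((i : ℝ⟦X⟧) - (a : ℝ⟦X⟧) * X) * genTerm (a :: u) i) *
            genSeries (b :: v)) +
          coeff n (genSeries (a :: u) *
            mk (fun i => ((i : ℝ⟦X⟧) - (b : ℝ⟦X⟧) * X) * genTerm (b :: v) i)) := by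
        simp only [coeff_mul, Finset.mul_sum, ← Finset.sum_add_distrib]
        refine Finset.sum_congr rfl fun x hx => ?_
        rw [← Finset.HasAntidiagonal.mem_antidiagonal.mp hx]
        simp only [genSeries, coeff_mk]
        push_cast
        ring
      have hmk : ∀ (c : ℕ) (w : List ℕ),
          (mk (fun i => ((i : ℝ⟦X⟧) - (c : ℝ⟦X⟧) * X) * genTerm (c :: w) i) : ℝ⟦X⟧⟦X⟧) =
            C (X : ℝ⟦X⟧) * (X * (genSeries w * mk 1)) := by
        intro c w
        ext1 i
        rw [coeff_mk, sub_mul_genTerm_cons, coeff_C_mul]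
      rw [key, hmk, hmk, ← coeff_C_mul, ← map_add]
      congr 1
      ring
  termination_by u.length + v.length

/-- The sum of the truncated generating functions of the words in a shuffle product. -/
noncomputable def shuffleGen (u v : List ℕ) : ℕ → ℝ⟦X⟧ := ((shuffleWords u v).map truncGen).sum

lemma shuffleGen_apply (u v : List ℕ) (N : ℕ) :
    shuffleGen u v N =
      ∑ n ∈ Finset.range (N + 1), ∑ x ∈ Finset.HasAntidiagonal.antidiagonal n, genTerm u x.1 * genTerm v x.2 := by
  have h : ∀ L : List (List ℕ), (L.map truncGen).sum N =
      ∑ n ∈ Finset.range (N + 1), coeff n (L.map genSeries).sum := by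
    intro L
    induction L with
    | nil => simp
    | cons w L ih => simp [ih, Finset.sum_add_distrib, ← sum_genTerm, genSeries]
  rw [shuffleGen, h, ← genSeries_mul_genSeries]
  simp [coeff_mul, genSeries]

/-- The shuffle product formula, up to a negligible error. -/
lemma decays_shuffle (a : ℕ) (u : List ℕ) (c : ℕ) (v : List ℕ) :
    CoeffDecaysBy 1 (truncGen (a :: u) * (truncGen (c :: v) - truncGen (0 :: v)) -
      (shuffleGen (a :: u) (c :: v) - shuffleGen (a :: u) (0 :: v))) := by
  have hu : CoeffDecaysBy 1 fun n => genTerm (a :: u) (n + 1) := by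
    simp only [genTerm_cons_succ]
    exact (decays_letter a).mul (decays_truncGen u)
  have hv : CoeffDecaysBy 2 fun n => genTerm (c :: v) (n + 1) - genTerm (0 :: v) (n + 1) := by
    simp only [genTerm_cons_succ, ← sub_mul]
    exact (decays_letter_sub c).mul (decays_truncGen v)
  convert hu.convolutionTail hv using 1
  funext N
  -- Terms of index 0 vanish, so after shifting both indices by one the triangle i + j ≤ N becomes i
  -- + j + 2 ≤ N.
  have hdiag : ∀ α β : ℕ → ℝ⟦X⟧, α 0 = 0 → β 0 = 0 →
      ∑ n ∈ Finset.range (N + 1), ∑ x ∈ Finset.HasAntidiagonal.antidiagonal n, α x.1 * β x.2 =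
        ∑ i ∈ Finset.range N, ∑ j ∈ Finset.range N,
          if N < i + j + 2 then 0 else α (i + 1) * β (j + 1) := by
    intro α β hα hβ
    have h1 : ∀ n ∈ Finset.range (N + 1), ∑ x ∈ Finset.HasAntidiagonal.antidiagonal n, α x.1 * β x.2 =
        ∑ i ∈ Finset.range (N + 1), ∑ j ∈ Finset.range (N + 1),
          if i + j = n then α i * β j else 0 := by
      intro n hn
      rw [← Finset.sum_product', ← Finset.sum_filter]
      refine Finset.sum_congr ?_ fun _ _ => rfl
      ext x
      simp only [Finset.HasAntidiagonal.mem_antidiagonal, Finset.mem_filter, Finset.mem_product, Finset.mem_range]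
        at hn ⊢
      omega
    rw [Finset.sum_congr rfl h1, Finset.sum_comm]
    have h2 : ∀ i ∈ Finset.range (N + 1), ∑ n ∈ Finset.range (N + 1), ∑ j ∈ Finset.range (N + 1),
        (if i + j = n then α i * β j else 0) =
        ∑ j ∈ Finset.range (N + 1), if i + j < N + 1 then α i * β j else 0 := by
      intro i _
      rw [Finset.sum_comm]
      refine Finset.sum_congr rfl fun j _ => ?_
      rw [Finset.sum_ite_eq]
      simp
    rw [Finset.sum_congr rfl h2, Finset.sum_range_succ']
    simp only [hα, zero_mul, ite_self, Finset.sum_const_zero, add_zero]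
    refine Finset.sum_congr rfl fun i _ => ?_
    rw [Finset.sum_range_succ']
    simp only [hβ, mul_zero, ite_self, add_zero]
    refine Finset.sum_congr rfl fun j _ => ?_
    have h3 : i + 1 + (j + 1) < N + 1 ↔ ¬ N < i + j + 2 := by omega
    simp only [h3, ite_not]
  have hprod : ∀ c : ℕ, truncGen (a :: u) N * truncGen (c :: v) N - shuffleGen (a :: u) (c :: v) N =
      ∑ i ∈ Finset.range N, ∑ j ∈ Finset.range N,
        if N < i + j + 2 then genTerm (a :: u) (i + 1) * genTerm (c :: v) (j + 1) else 0 := by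
    intro c
    rw [shuffleGen_apply, hdiag _ _ (genTerm_cons_zero a u) (genTerm_cons_zero c v),
      ← sum_genTerm, ← sum_genTerm, Finset.sum_range_succ', Finset.sum_range_succ' (genTerm (c :: v)),
      genTerm_cons_zero, genTerm_cons_zero, add_zero, add_zero, Finset.sum_mul_sum,
      ← Finset.sum_sub_distrib]
    refine Finset.sum_congr rfl fun i _ => ?_
    rw [← Finset.sum_sub_distrib]
    refine Finset.sum_congr rfl fun j _ => ?_
    split_ifs <;> simp
  have e : (truncGen (a :: u) * (truncGen (c :: v) - truncGen (0 :: v)) -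
      (shuffleGen (a :: u) (c :: v) - shuffleGen (a :: u) (0 :: v))) N =
      (truncGen (a :: u) N * truncGen (c :: v) N - shuffleGen (a :: u) (c :: v) N) -
      (truncGen (a :: u) N * truncGen (0 :: v) N - shuffleGen (a :: u) (0 :: v) N) := by
    simp only [Pi.sub_apply, Pi.mul_apply]
    ring
  rw [e, hprod, hprod, ← Finset.sum_sub_distrib]
  refine Finset.sum_congr rfl fun i _ => ?_
  rw [← Finset.sum_sub_distrib]
  refine Finset.sum_congr rfl fun j _ => ?_
  split_ifs
  · ring
  · simp

/-! ### Double shuffle relations modulo negligible sequences -/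

/-- Sequences of power series whose coefficients are all `O((log N) ^ k / N)`. -/
def negligible : Submodule ℝ (ℕ → ℝ⟦X⟧) where
  carrier := {u | CoeffDecaysBy 1 u}
  add_mem' := CoeffDecaysBy.add
  zero_mem' := CoeffDecaysBy.zero
  smul_mem' c _ := CoeffDecaysBy.const_smul c

lemma mem_negligible {u : ℕ → ℝ⟦X⟧} : u ∈ negligible ↔ CoeffDecaysBy 1 u := Iff.rfl

/-- A factor P of logarithmic growth keeps the error negligible, so shuffle relations of low depth
can be multiplied up to total depth four. -/
lemma mkQ_mul_shuffle {P : ℕ → ℝ⟦X⟧} (hP : CoeffDecaysBy 0 P) (a : ℕ) (u : List ℕ) (c : ℕ)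
    (v : List ℕ) :
    negligible.mkQ (P * (truncGen (a :: u) * truncGen (c :: v))) -
        negligible.mkQ (P * (truncGen (a :: u) * truncGen (0 :: v))) =
      negligible.mkQ (P * shuffleGen (a :: u) (c :: v)) -
        negligible.mkQ (P * shuffleGen (a :: u) (0 :: v)) := by
  have h : P * (truncGen (a :: u) * (truncGen (c :: v) - truncGen (0 :: v)) -
      (shuffleGen (a :: u) (c :: v) - shuffleGen (a :: u) (0 :: v))) ∈ negligible := by
    have h' := hP.mul (decays_shuffle a u c v)
    exact h'.mono le_rfl
  rw [← sub_eq_zero, ← map_sub, ← map_sub, ← map_sub]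
  rw [← Submodule.Quotient.mk_eq_zero] at h
  rw [← h]
  simp only [Submodule.mkQ_apply]
  congr 1
  ring

lemma mkQ_shuffle (a : ℕ) (u : List ℕ) (c : ℕ) (v : List ℕ) :
    negligible.mkQ (truncGen (a :: u) * truncGen (c :: v)) -
        negligible.mkQ (truncGen (a :: u) * truncGen (0 :: v)) =
      negligible.mkQ (shuffleGen (a :: u) (c :: v)) -
        negligible.mkQ (shuffleGen (a :: u) (0 :: v)) := by
  have h := mkQ_mul_shuffle (P := 1) (CoeffDecaysBy.const 1) a u c v
  simpa only [one_mul] using h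

/-- Needed as a multiplier: the square of a letter is a stuffle diagonal that partial fractions
cannot reduce, so this sum is not written as a `truncGen`. -/
lemma decays_cumul_letter_mul_self (c : ℕ) : CoeffDecaysBy 0 (cumul (letter c * letter c) 1) :=
  CoeffDecaysBy.cumul (((decays_letter c).mul (decays_letter c)).mono (by norm_num))
    (CoeffDecaysBy.const 1)

section PartialFractions

variable (f : ℕ → ℝ⟦X⟧)

lemma letter_one_mul_zero : letter 1 * letter 0 = letter 1 - letter 0 := by
  simpa using letter_mul_letter 1 0

lemma letter_zero_mul_one : letter 0 * letter 1 = letter 1 - letter 0 := by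
  rw [mul_comm, letter_one_mul_zero]

lemma letter_two_mul_one : letter 2 * letter 1 = letter 2 - letter 1 := by
  have h := letter_mul_letter 2 1
  norm_num at h
  exact h

lemma letter_one_mul_two : letter 1 * letter 2 = letter 2 - letter 1 := by
  rw [mul_comm, letter_two_mul_one]

lemma letter_two_mul_zero : letter 2 * letter 0 = (1 / 2 : ℝ) • (letter 2 - letter 0) := by
  rw [← letter_mul_letter 2 0, smul_smul]
  norm_num

lemma letter_zero_mul_two : letter 0 * letter 2 = (1 / 2 : ℝ) • (letter 2 - letter 0) := by
  rw [mul_comm, letter_two_mul_zero]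

/-- The variants with a trailing factor let `simp` apply partial fractions inside the
right-associated products left by `mul_assoc`. -/
lemma letter_one_mul_zero_mul : letter 1 * (letter 0 * f) = (letter 1 - letter 0) * f := by
  rw [← mul_assoc, letter_one_mul_zero]

lemma letter_zero_mul_one_mul : letter 0 * (letter 1 * f) = (letter 1 - letter 0) * f := by
  rw [← mul_assoc, letter_zero_mul_one]

lemma letter_two_mul_one_mul : letter 2 * (letter 1 * f) = (letter 2 - letter 1) * f := by
  rw [← mul_assoc, letter_two_mul_one]

lemma letter_one_mul_two_mul : letter 1 * (letter 2 * f) = (letter 2 - letter 1) * f := by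
  rw [← mul_assoc, letter_one_mul_two]

lemma letter_two_mul_zero_mul :
    letter 2 * (letter 0 * f) = (1 / 2 : ℝ) • ((letter 2 - letter 0) * f) := by
  rw [← mul_assoc, letter_two_mul_zero, smul_mul_assoc]

lemma letter_zero_mul_two_mul :
    letter 0 * (letter 2 * f) = (1 / 2 : ℝ) • ((letter 2 - letter 0) * f) := by
  rw [← mul_assoc, letter_zero_mul_two, smul_mul_assoc]

end PartialFractions

/-! ### Relations among the depth-four classes -/

/-- The class of `truncGen (c :: w) - truncGen (0 :: w)` modulo negligible sequences. -/
noncomputable def genDiff (c : ℕ) (w : List ℕ) : (ℕ → ℝ⟦X⟧) ⧸ negligible :=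
  negligible.mkQ (truncGen (c :: w)) - negligible.mkQ (truncGen (0 :: w))

set_option linter.unusedSimpArgs false

/-- The sum formula in generating form: in degree l ≥ 5 only the `letter 1` term on the right
survives, with coefficient ζ(l). -/
lemma genDiff_one_one_one_one :
    genDiff 1 [1, 1, 1] =
      negligible.mkQ (cumul (letter 1 ^ 1) 1)
        - negligible.mkQ (cumul (letter 0 ^ 1) 1)
        - negligible.mkQ (cumul (letter 0 ^ 2) 1)
        - negligible.mkQ (cumul (letter 0 ^ 3) 1)
        - negligible.mkQ (cumul (letter 0 ^ 4) 1) := by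
  have h1 := mkQ_mul_shuffle (decays_truncGen [0, 0]) 0 [] 1 []
  have h2 := mkQ_mul_shuffle (decays_truncGen [0]) 0 [0] 1 []
  have h3 := mkQ_mul_shuffle (decays_truncGen [0]) 0 [] 1 [1]
  have h4 := mkQ_mul_shuffle (decays_cumul_letter_mul_self 0) 0 [] 1 []
  have h5 := mkQ_shuffle 0 [0] 1 [1]
  have h6 := mkQ_shuffle 0 [0, 0] 1 []
  have h7 := mkQ_shuffle 0 [] 1 [1, 1]
  -- Stuffles and partial fractions turn every product into a linear combination of nested sums;
  -- what remains is linear algebra over those classes.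
  simp only [shuffleGen, shuffleWords, truncGen, genDiff, List.map_cons, List.map_nil,
    List.sum_cons, List.sum_nil, List.cons_append, List.nil_append, List.append_nil,
    Nat.reduceAdd, cumul_mul_cumul, mul_one, one_mul, mul_add, add_mul, mul_sub, sub_mul,
    add_zero, zero_add, cumul_add, cumul_sub, add_cumul, sub_cumul, map_add, map_sub, pow_succ,
    pow_zero, mul_assoc, letter_one_mul_zero, letter_zero_mul_one, letter_one_mul_zero_mul,
    letter_zero_mul_one_mul]
    at h1 h2 h3 h4 h5 h6 h7 ⊢
  linear_combination (norm := module) -h1 + h2 - h3 - h4 + h5 - h6 - h7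

lemma genDiff_relation_depths_two_two :
    (4 : ℝ) • genDiff 2 [2, 2, 1]
        + (2 : ℝ) • genDiff 2 [2, 1, 1]
        - (4 : ℝ) • genDiff 1 [2, 2, 1]
        - (2 : ℝ) • genDiff 1 [2, 1, 1]
        - (4 : ℝ) • genDiff 1 [1, 2, 1] =
      -(2 : ℝ) • negligible.mkQ (cumul (letter 1 ^ 1) 1)
        + negligible.mkQ (cumul (letter 1 ^ 2) 1)
        + (2 : ℝ) • negligible.mkQ (cumul (letter 0 ^ 1) 1)
        + negligible.mkQ (cumul (letter 0 ^ 2) 1)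
        - negligible.mkQ (cumul (letter 0 ^ 4) 1) := by
  have hsum := genDiff_one_one_one_one
  have h1 := mkQ_mul_shuffle (decays_truncGen [0, 1]) 0 [] 1 []
  have h2 := mkQ_mul_shuffle (decays_truncGen [0]) 0 [] 1 []
  have h3 := mkQ_mul_shuffle (decays_cumul_letter_mul_self 0) 0 [] 1 []
  have h4 := mkQ_mul_shuffle (decays_truncGen [1, 1]) 0 [] 1 []
  have h5 := mkQ_mul_shuffle (decays_truncGen [1]) 0 [] 1 []
  have h6 := mkQ_shuffle 0 [0] 1 [0]
  have h7 := mkQ_shuffle 0 [0, 0] 1 []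
  have h8 := mkQ_shuffle 0 [1] 1 [0]
  have h9 := mkQ_shuffle 0 [1] 1 [1]
  have h10 := mkQ_shuffle 0 [1, 0] 1 []
  have h11 := mkQ_shuffle 0 [] 1 [0, 0]
  have h12 := mkQ_shuffle 0 [] 1 [0, 1]
  have h13 := mkQ_shuffle 1 [1] 1 [1]
  simp only [shuffleGen, shuffleWords, truncGen, genDiff, List.map_cons, List.map_nil,
    List.sum_cons, List.sum_nil, List.cons_append, List.nil_append, List.append_nil,
    Nat.reduceAdd, cumul_mul_cumul, mul_one, one_mul, mul_add, add_mul, mul_sub, sub_mul,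
    add_zero, zero_add, cumul_add, cumul_sub, add_cumul, sub_cumul, map_add, map_sub, pow_succ,
    pow_zero, mul_assoc, letter_one_mul_zero, letter_zero_mul_one, letter_one_mul_zero_mul,
    letter_zero_mul_one_mul]
    at hsum h1 h2 h3 h4 h5 h6 h7 h8 h9 h10 h11 h12 h13 ⊢
  -- The words beginning with 2 all come from `h13`, where [1,1] is shuffled with itself; the other
  -- relations cancel the remaining nested sums.
  linear_combination (norm := module) (2 : ℝ) • hsum + h1 + h2 + h3 - h4 - h5 - (2 : ℝ) • h6 +
    (2 : ℝ) • h7 + (2 : ℝ) • h8 + h9 - (2 : ℝ) • h10 + (2 : ℝ) • h11 - (2 : ℝ) • h12 - h13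

lemma genDiff_relation_depths_one_three :
    (2 : ℝ) • genDiff 2 [2, 2, 1]
        + genDiff 2 [2, 1, 1]
        + genDiff 2 [1, 1, 1]
        - (2 : ℝ) • genDiff 1 [2, 2, 1]
        - genDiff 1 [2, 1, 1] =
      negligible.mkQ (cumul (letter 1 ^ 1) 1)
        + negligible.mkQ (cumul (letter 1 ^ 2) 1)
        - negligible.mkQ (cumul (letter 0 ^ 1) 1)
        - (2 : ℝ) • negligible.mkQ (cumul (letter 0 ^ 2) 1)
        - (3 : ℝ) • negligible.mkQ (cumul (letter 0 ^ 3) 1)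
        - (4 : ℝ) • negligible.mkQ (cumul (letter 0 ^ 4) 1) := by
  have hsum := genDiff_one_one_one_one
  have h1 := mkQ_mul_shuffle (decays_truncGen [0]) 0 [] 1 []
  have h2 := mkQ_mul_shuffle (decays_truncGen [1, 1]) 0 [] 1 []
  have h3 := mkQ_mul_shuffle (decays_truncGen [1]) 0 [0] 1 []
  have h4 := mkQ_mul_shuffle (decays_truncGen [1]) 0 [] 1 [0]
  have h5 := mkQ_mul_shuffle (decays_truncGen [1]) 0 [] 1 []
  have h6 := mkQ_shuffle 0 [0] 1 [1]
  have h7 := mkQ_shuffle 0 [0, 1] 1 []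
  have h8 := mkQ_shuffle 0 [] 1 [1, 0]
  have h9 := mkQ_shuffle 0 [] 1 [1, 1]
  have h10 := mkQ_shuffle 1 [0] 1 [0]
  have h11 := mkQ_shuffle 1 [0, 0] 1 []
  have h12 := mkQ_shuffle 1 [1] 1 [1]
  have h13 := mkQ_shuffle 1 [1, 1] 1 []
  have h14 := mkQ_shuffle 1 [] 1 [0, 0]
  simp only [shuffleGen, shuffleWords, truncGen, genDiff, List.map_cons, List.map_nil,
    List.sum_cons, List.sum_nil, List.cons_append, List.nil_append, List.append_nil,
    Nat.reduceAdd, cumul_mul_cumul, mul_one, one_mul, mul_add, add_mul, mul_sub, sub_mul,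
    add_zero, zero_add, cumul_add, cumul_sub, add_cumul, sub_cumul, map_add, map_sub, pow_succ,
    pow_zero, mul_assoc, letter_one_mul_zero, letter_zero_mul_one, letter_one_mul_zero_mul,
    letter_zero_mul_one_mul]
    at hsum h1 h2 h3 h4 h5 h6 h7 h8 h9 h10 h11 h12 h13 h14 ⊢
  linear_combination (norm := module) (4 : ℝ) • hsum + h1 - h2 + h3 - h4 - h5 + h6 - h7 - h8 + h9
    + h10 - h11 - h12 + h13 - h14

set_option maxHeartbeats 2000000 in
lemma genDiff_relation_depths_one_one_two :
    (12 : ℝ) • genDiff 4 [3, 2, 1]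
        - (12 : ℝ) • genDiff 2 [3, 2, 1]
        - (4 : ℝ) • genDiff 2 [1, 2, 1] =
      -(2 : ℝ) • negligible.mkQ (cumul (letter 1 ^ 1) 1)
        + negligible.mkQ (cumul (letter 1 ^ 2) 1)
        + (2 : ℝ) • negligible.mkQ (cumul (letter 1 ^ 3) 1)
        + (1/2 : ℝ) • negligible.mkQ (cumul (letter 1 ^ 4) 1)
        + (2 : ℝ) • negligible.mkQ (cumul (letter 0 ^ 1) 1)
        + negligible.mkQ (cumul (letter 0 ^ 2) 1)
        - (2 : ℝ) • negligible.mkQ (cumul (letter 0 ^ 3) 1)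
        - (15/2 : ℝ) • negligible.mkQ (cumul (letter 0 ^ 4) 1) := by
  have hsum := genDiff_one_one_one_one
  have hot := genDiff_relation_depths_one_three
  have htt := genDiff_relation_depths_two_two
  have h1 := mkQ_mul_shuffle (decays_truncGen [0, 1]) 1 [] 1 []
  have h2 := mkQ_mul_shuffle (decays_truncGen [0]) 1 [] 1 []
  have h3 := mkQ_mul_shuffle (decays_truncGen [1, 1]) 0 [] 1 []
  have h4 := mkQ_mul_shuffle (decays_truncGen [1, 1]) 1 [] 1 []
  have h5 := mkQ_mul_shuffle (decays_truncGen [1]) 0 [0] 1 []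
  have h6 := mkQ_mul_shuffle (decays_truncGen [1]) 0 [] 1 [0]
  have h7 := mkQ_mul_shuffle (decays_truncGen [1]) 1 [] 1 []
  have h8 := mkQ_mul_shuffle (decays_cumul_letter_mul_self 1) 0 [] 1 []
  have h9 := mkQ_mul_shuffle (decays_cumul_letter_mul_self 1) 1 [] 1 []
  have h10 := mkQ_mul_shuffle (decays_truncGen [2, 1]) 1 [] 1 []
  have h11 := mkQ_shuffle 0 [1] 1 [1]
  have h12 := mkQ_shuffle 0 [1] 2 [1]
  have h13 := mkQ_shuffle 0 [1, 1] 1 []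
  have h14 := mkQ_shuffle 0 [] 1 [1, 1]
  have h15 := mkQ_shuffle 1 [0] 1 [1]
  have h16 := mkQ_shuffle 1 [0, 1] 1 []
  have h17 := mkQ_shuffle 1 [1] 1 [0]
  have h18 := mkQ_shuffle 1 [1] 1 [1]
  have h19 := mkQ_shuffle 1 [1, 0] 1 []
  have h20 := mkQ_shuffle 1 [] 1 [0, 1]
  have h21 := mkQ_shuffle 1 [] 1 [1, 0]
  have h22 := mkQ_shuffle 1 [] 1 [1, 1]
  have h23 := mkQ_shuffle 2 [1] 2 [1]
  simp only [shuffleGen, shuffleWords, truncGen, genDiff, List.map_cons, List.map_nil,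
    List.sum_cons, List.sum_nil, List.cons_append, List.nil_append, List.append_nil,
    Nat.reduceAdd, cumul_mul_cumul, mul_one, one_mul, mul_add, add_mul, mul_sub, sub_mul,
    add_zero, zero_add, cumul_add, cumul_sub, add_cumul, sub_cumul, map_add, map_sub, pow_succ,
    pow_zero, mul_assoc, letter_one_mul_zero, letter_zero_mul_one, letter_one_mul_zero_mul,
    letter_zero_mul_one_mul, letter_two_mul_one, letter_one_mul_two, letter_two_mul_zero,
    letter_zero_mul_two, letter_two_mul_one_mul, letter_one_mul_two_mul, letter_two_mul_zero_mul,
    letter_zero_mul_two_mul, smul_sub, smul_mul_assoc, mul_smul_comm, smul_cumul, cumul_smul,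
    map_smul]
    at hsum hot htt h1 h2 h3 h4 h5 h6 h7 h8 h9 h10 h11 h12 h13 h14 h15 h16 h17 h18 h19 h20 h21
      h22 h23 ⊢
  -- Only `h23` produces the entry 4: shuffling [2,1] with itself gives six copies of [4,3,2,1], and
  -- the factor 2 makes twelve.
  linear_combination (norm := module) -(13 : ℝ) • hsum + (5 : ℝ) • hot + (1/2 : ℝ) • htt +
    (5/2 : ℝ) • h1 - (1/2 : ℝ) • h2 - (3 : ℝ) • h3 - (3/2 : ℝ) • h4 + (3 : ℝ) • h5 - (3 : ℝ) • h6
    + (1/2 : ℝ) • h7 - (3 : ℝ) • h8 - (1/2 : ℝ) • h9 - h10 - (3/2 : ℝ) • h11 + (2 : ℝ) • h12 -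
    h13 - (2 : ℝ) • h14 - h15 + h16 + (3 : ℝ) • h17 + (5/2 : ℝ) • h18 - (3 : ℝ) • h19 -
    (3 : ℝ) • h20 + h21 + h22 - (2 : ℝ) • h23

/-! ### Truncated multiple zeta values and convergence -/

/-- The truncated multiple zeta value, the sum over `N ≥ m₁ > ⋯ > mₙ > 0`. -/
noncomputable def truncZeta : (n : ℕ) → (Fin n → ℕ) → ℕ → ℝ
  | 0, _ => 1
  | n + 1, k => cumul (fun m => 1 / (m : ℝ) ^ k 0) (truncZeta n (Fin.tail k))

/-- The index tuples `N ≥ m₁ > ⋯ > mₙ > 0`. -/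
def boundedIndices (n N : ℕ) : Finset (Fin n → ℕ) :=
  (Fintype.piFinset fun _ => Finset.Icc 1 N).filter StrictAnti

lemma mem_boundedIndices {n N : ℕ} {m : Fin n → ℕ} :
    m ∈ boundedIndices n N ↔ (∀ i, 1 ≤ m i ∧ m i ≤ N) ∧ StrictAnti m := by
  simp [boundedIndices, Fintype.mem_piFinset]

lemma cons_mem_boundedIndices {n N a : ℕ} {m : Fin n → ℕ} :
    (Fin.cons (a + 1) m : Fin (n + 1) → ℕ) ∈ boundedIndices (n + 1) N ↔
      a < N ∧ m ∈ boundedIndices n a := by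
  simp only [mem_boundedIndices, Fin.forall_fin_succ, Fin.cons_zero, Fin.cons_succ]
  constructor
  · rintro ⟨⟨h0, h1⟩, h2⟩
    refine ⟨by omega, fun i => ⟨(h1 i).1, ?_⟩, fun i j hij => ?_⟩
    · have := h2 (Fin.succ_pos i)
      simp only [Fin.cons_zero, Fin.cons_succ] at this
      omega
    · simpa using h2 (Fin.succ_lt_succ_iff.mpr hij)
  · rintro ⟨h0, h1, h2⟩
    refine ⟨⟨by omega, fun i => ⟨(h1 i).1, by have := (h1 i).2; omega⟩⟩, ?_⟩
    intro i j hij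
    cases j using Fin.cases with
    | zero => exact absurd hij (Fin.not_lt_zero i)
    | succ j =>
      cases i using Fin.cases with
      | zero =>
        have := (h1 j).2
        simp only [Fin.cons_zero, Fin.cons_succ]
        omega
      | succ i => simpa using h2 (Fin.succ_lt_succ_iff.mp hij)

lemma truncZeta_eq_sum (n : ℕ) (k : Fin n → ℕ) (N : ℕ) :
    truncZeta n k N = ∑ m ∈ boundedIndices n N, 1 / ∏ i, (m i : ℝ) ^ k i := by
  induction n generalizing N with
  | zero =>
    have h : boundedIndices 0 N = Finset.univ := by
      ext m
      simp only [mem_boundedIndices, Subsingleton.strictAnti, Finset.mem_univ, and_true, iff_true]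
      exact fun i => i.elim0
    simp [truncZeta, h]
  | succ n ih =>
    simp only [truncZeta, cumul, ih, Finset.mul_sum]
    rw [Finset.sum_sigma']
    refine Finset.sum_bij' (fun x _ => (Fin.cons (x.1 + 1) x.2 : Fin (n + 1) → ℕ))
      (fun m _ => ⟨m 0 - 1, Fin.tail m⟩) ?_ ?_ ?_ ?_ ?_
    · rintro ⟨a, m⟩ h
      rw [Finset.mem_sigma, Finset.mem_range] at h
      exact cons_mem_boundedIndices.mpr h
    · intro m h
      have h0 := ((mem_boundedIndices.mp h).1 0).1
      rw [← Fin.cons_self_tail m, show m 0 = (m 0 - 1) + 1 by omega] at h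
      rw [Finset.mem_sigma, Finset.mem_range]
      exact cons_mem_boundedIndices.mp h
    · rintro ⟨a, m⟩ _
      simp
    · intro m h
      have h0 := ((mem_boundedIndices.mp h).1 0).1
      simp only [Nat.sub_add_cancel h0, Fin.cons_self_tail]
    · rintro ⟨a, m⟩ _
      rw [Fin.prod_univ_succ]
      simp only [Fin.cons_zero, Fin.cons_succ, Fin.tail]
      rw [one_div_mul_one_div]

lemma decays_one_div_pow {k p : ℕ} (h : p ≤ k) :
    DecaysBy p fun m => 1 / ((m + 1 : ℕ) : ℝ) ^ k := by
  refine ⟨1, 0, zero_le_one, fun N => ?_⟩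
  rw [abs_of_nonneg (by positivity), pow_zero, mul_one]
  push_cast
  gcongr
  simp

lemma decays_truncZeta (n : ℕ) (k : Fin n → ℕ) (hk : ∀ i, 1 ≤ k i) :
    DecaysBy 0 (truncZeta n k) := by
  induction n with
  | zero => exact DecaysBy.const 1
  | succ n ih =>
    exact ((decays_one_div_pow (hk 0)).mul (ih (Fin.tail k) fun i => hk i.succ)).cumulativeSum

lemma DecaysBy.summable {u : ℕ → ℝ} (hu : DecaysBy 2 u) : Summable u := by
  obtain ⟨C, k, hC, h⟩ := hu
  -- The exponent 2k is chosen so that a square root gives `harmBound N ^ k` ≤ √B · √(N + 1), and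
  -- the terms are dominated by a multiple of (N + 1)^(-3/2).
  obtain ⟨B, hB⟩ := (tendsto_harmBound_pow_div (2 * k)).bddAbove_range
  have hB0 : 0 ≤ B := le_trans (by have := harmBound_pos 0; positivity) (hB ⟨0, rfl⟩)
  have hs : Summable fun N : ℕ => C * Real.sqrt B * (1 / ((N + 1 : ℕ) : ℝ) ^ (3 / 2 : ℝ)) := by
    refine Summable.mul_left _ ?_
    exact (summable_nat_add_iff 1).mpr (Real.summable_one_div_nat_rpow.mpr (by norm_num))
  refine Summable.of_norm_bounded hs fun N => (h N).trans ?_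
  have hpos := harmBound_pos N
  have hN : (0 : ℝ) < (N : ℝ) + 1 := by positivity
  have h1 : harmBound N ^ k ≤ Real.sqrt B * ((N : ℝ) + 1) ^ (1 / 2 : ℝ) := by
    rw [← Real.sqrt_eq_rpow, ← Real.sqrt_mul hB0]
    refine Real.le_sqrt_of_sq_le ?_
    have h2 : harmBound N ^ (2 * k) / ((N : ℝ) + 1) ≤ B := hB ⟨N, rfl⟩
    rw [div_le_iff₀ hN] at h2
    rwa [← pow_mul, mul_comm k 2]
  have h3 : ((N : ℝ) + 1) ^ 2 = ((N : ℝ) + 1) ^ (1 / 2 : ℝ) * ((N : ℝ) + 1) ^ (3 / 2 : ℝ) := by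
    rw [← Real.rpow_add hN]
    norm_num
  rw [div_le_iff₀ (by positivity), h3]
  push_cast
  calc C * harmBound N ^ k ≤ C * (Real.sqrt B * ((N : ℝ) + 1) ^ (1 / 2 : ℝ)) := by gcongr
    _ = _ := by field_simp

lemma mzvTerm_nonneg {n : ℕ} (s : Fin n → ℕ) (m : MZVIndex n) : 0 ≤ mzvTerm s m := by
  unfold mzvTerm
  positivity

/-- The elements of `MZVIndex n` with entries at most `N`. -/
def boundedMZVIndices (n N : ℕ) : Finset (MZVIndex n) :=
  (boundedIndices n N).subtype _

lemma sum_boundedMZVIndices (n : ℕ) (k : Fin n → ℕ) (N : ℕ) :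
    ∑ m ∈ boundedMZVIndices n N, mzvTerm k m = truncZeta n k N := by
  rw [truncZeta_eq_sum, boundedMZVIndices]
  unfold mzvTerm
  rw [Finset.sum_subtype_of_mem (fun m : Fin n → ℕ => 1 / ∏ i, (m i : ℝ) ^ k i)]
  intro m hm
  rw [mem_boundedIndices] at hm
  exact ⟨hm.2, fun i => (hm.1 i).1⟩

lemma tendsto_boundedMZVIndices (n : ℕ) :
    Filter.Tendsto (boundedMZVIndices n) Filter.atTop Filter.atTop := by
  refine Filter.tendsto_atTop_finset_of_monotone (fun M N hMN m hm => ?_) fun m => ?_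
  · simp only [boundedMZVIndices, Finset.mem_subtype, mem_boundedIndices] at hm ⊢
    exact ⟨fun i => ⟨(hm.1 i).1, (hm.1 i).2.trans hMN⟩, hm.2⟩
  · refine ⟨∑ i, m.1 i, ?_⟩
    simp only [boundedMZVIndices, Finset.mem_subtype, mem_boundedIndices]
    exact ⟨fun i => ⟨m.2.2 i, Finset.single_le_sum (f := m.1) (fun _ _ => Nat.zero_le _)
      (Finset.mem_univ i)⟩, m.2.1⟩

/-- The terms are nonnegative and every finite set of indices lies in a truncation, so it suffices
to bound the truncations. Summing over the outermost index, they are partial sums of a series with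
terms O((log m)^j / m²). -/
lemma summable_mzvTerm {n : ℕ} {k : Fin (n + 1) → ℕ} (h0 : 2 ≤ k 0) (hk : ∀ i, 1 ≤ k i) :
    Summable (mzvTerm k) := by
  have hs : Summable fun m : ℕ => 1 / ((m + 1 : ℕ) : ℝ) ^ k 0 * truncZeta n (Fin.tail k) m :=
    ((decays_one_div_pow h0).mul (decays_truncZeta n (Fin.tail k) fun i => hk i.succ)).summable
  have hnn : ∀ (n : ℕ) (k : Fin n → ℕ) (N : ℕ), 0 ≤ truncZeta n k N := by
    intro n k N
    rw [← sum_boundedMZVIndices]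
    exact Finset.sum_nonneg fun m _ => mzvTerm_nonneg k m
  refine summable_of_sum_le (c := ∑' m : ℕ, 1 / ((m + 1 : ℕ) : ℝ) ^ k 0 *
    truncZeta n (Fin.tail k) m) (mzvTerm_nonneg k) fun s => ?_
  obtain ⟨N, hN⟩ := (Filter.tendsto_atTop.mp (tendsto_boundedMZVIndices (n + 1)) s).exists
  refine (Finset.sum_le_sum_of_subset_of_nonneg hN fun m _ _ => mzvTerm_nonneg k m).trans ?_
  rw [sum_boundedMZVIndices, truncZeta, cumul]
  exact hs.sum_le_tsum _ fun m _ => mul_nonneg (by positivity) (hnn _ _ _)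

lemma tendsto_truncZeta {n : ℕ} {k : Fin (n + 1) → ℕ} (h0 : 2 ≤ k 0) (hk : ∀ i, 1 ≤ k i) :
    Filter.Tendsto (truncZeta (n + 1) k) Filter.atTop (nhds (multipleZeta k)) := by
  have h := (summable_mzvTerm h0 hk).hasSum.comp (tendsto_boundedMZVIndices (n + 1))
  refine h.congr fun N => ?_
  rw [← sum_boundedMZVIndices]
  rfl

/-! ### Coefficients of the generating functions -/

lemma coeff_letter (c m d : ℕ) :
    coeff d (letter c m) = (if d = 0 then 0 else (c : ℝ) ^ (d - 1)) * (1 / (m : ℝ) ^ d) := by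
  cases d with
  | zero => simp [coeff_zero_letter]
  | succ d => simp [coeff_succ_letter, div_eq_mul_inv]

lemma sum_antidiagonalTuple_succ (n d : ℕ) (g : (Fin (n + 1) → ℕ) → ℝ) :
    ∑ k ∈ Finset.Nat.antidiagonalTuple (n + 1) d, g k =
      ∑ p ∈ Finset.HasAntidiagonal.antidiagonal d,
        ∑ t ∈ Finset.Nat.antidiagonalTuple n p.2, g (Fin.cons p.1 t) := by
  rw [Finset.sum_sigma']
  refine Finset.sum_bij' (fun k _ => ⟨(k 0, ∑ i, Fin.tail k i), Fin.tail k⟩)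
    (fun x _ => (Fin.cons x.1.1 x.2 : Fin (n + 1) → ℕ)) ?_ ?_ ?_ ?_ ?_
  · intro k hk
    rw [Finset.Nat.mem_antidiagonalTuple, Fin.sum_univ_succ] at hk
    simp only [Finset.mem_sigma, Finset.HasAntidiagonal.mem_antidiagonal,
      Finset.Nat.mem_antidiagonalTuple, and_true]
    exact hk
  · rintro ⟨⟨a, b⟩, t⟩ h
    simp only [Finset.mem_sigma, Finset.HasAntidiagonal.mem_antidiagonal,
      Finset.Nat.mem_antidiagonalTuple] at h
    rw [Finset.Nat.mem_antidiagonalTuple, Fin.sum_univ_succ]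
    simp [h.1, h.2]
  · intro k _
    simp
  · rintro ⟨⟨a, b⟩, t⟩ h
    simp only [Finset.mem_sigma, Finset.HasAntidiagonal.mem_antidiagonal,
      Finset.Nat.mem_antidiagonalTuple] at h
    simp [h.2]
  · intro k _
    simp

/-- A letter has no constant term, so tuples with a zero entry must drop out; the guard is needed
because 0 - 1 = 0 would give such an entry the weight 1. -/
lemma coeff_truncGen (n : ℕ) (w : Fin n → ℕ) (d N : ℕ) :
    coeff d (truncGen (List.ofFn w) N) = ∑ k ∈ Finset.Nat.antidiagonalTuple n d,
      (∏ i, if k i = 0 then 0 else (w i : ℝ) ^ (k i - 1)) * truncZeta n k N := by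
  induction n generalizing d N with
  | zero =>
    cases d with
    | zero => simp [truncGen, truncZeta]
    | succ d => simp [truncGen, coeff_one]
  | succ n ih =>
    rw [sum_antidiagonalTuple_succ]
    simp only [List.ofFn_succ, truncGen, truncZeta, cumul, map_sum, coeff_mul, ih, coeff_letter,
      Fin.prod_univ_succ, Fin.cons_zero, Fin.cons_succ, Fin.tail_cons]
    rw [Finset.sum_comm]
    refine Finset.sum_congr rfl fun p _ => ?_
    simp only [Finset.mul_sum]
    rw [Finset.sum_comm]
    refine Finset.sum_congr rfl fun t _ => Finset.sum_congr rfl fun m _ => ?_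
    ring

/-- Multiplying a power of the letter by m - cX lowers the exponent by one and brings out X; on
coefficients this is Pascal's recursion. -/
lemma coeff_letter_pow_succ (c : ℕ) {m : ℕ} (hm : m ≠ 0) (l j : ℕ) :
    coeff (l + 1) (letter c m ^ (j + 1)) =
      (l.choose j : ℝ) * (c : ℝ) ^ (l - j) * (1 / (m : ℝ) ^ (l + 1)) := by
  have hm' : (m : ℝ) ≠ 0 := by exact_mod_cast hm
  have hrec : ∀ l j : ℕ, (m : ℝ) * coeff (l + 1) (letter c m ^ (j + 1)) =
      c * coeff l (letter c m ^ (j + 1)) + coeff l (letter c m ^ j) := by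
    intro l j
    have h : (m : ℝ⟦X⟧) * letter c m ^ (j + 1) =
        (c : ℝ⟦X⟧) * (X * letter c m ^ (j + 1)) + X * letter c m ^ j := by
      have := sub_mul_letter c hm
      linear_combination letter c m ^ j * this
    have e1 : (m : ℝ⟦X⟧) = C (m : ℝ) := by simp
    have e2 : (c : ℝ⟦X⟧) = C (c : ℝ) := by simp
    rw [e1, e2] at h
    have h' := congrArg (coeff (l + 1)) h
    rwa [coeff_C_mul, map_add, coeff_C_mul, coeff_succ_X_mul, coeff_succ_X_mul] at h'
  have hzero : ∀ j : ℕ, coeff 0 (letter c m ^ (j + 1)) = 0 := by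
    intro j
    rw [coeff_zero_eq_constantCoeff_apply, map_pow, ← coeff_zero_eq_constantCoeff_apply,
      coeff_zero_letter, zero_pow (Nat.succ_ne_zero j)]
  apply mul_left_cancel₀ hm'
  induction l generalizing j with
  | zero =>
    rw [hrec, hzero]
    cases j with
    | zero => simp [hm']
    | succ j => rw [hzero]; simp
  | succ l ih =>
    have ih' : ∀ j, coeff (l + 1) (letter c m ^ (j + 1)) =
        (l.choose j : ℝ) * (c : ℝ) ^ (l - j) * (1 / (m : ℝ) ^ (l + 1)) :=
      fun j => mul_left_cancel₀ hm' (ih j)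
    rw [hrec, ih']
    cases j with
    | zero =>
      rw [pow_zero, coeff_one, if_neg (Nat.succ_ne_zero l)]
      simp only [Nat.choose_zero_right, Nat.sub_zero, pow_succ]
      field_simp
      ring
    | succ j =>
      rw [ih', Nat.choose_succ_succ, Nat.add_sub_add_right]
      have h : (c : ℝ) * ((l.choose (j + 1) : ℝ) * (c : ℝ) ^ (l - (j + 1))) =
          (l.choose (j + 1) : ℝ) * (c : ℝ) ^ (l - j) := by
        rcases Nat.lt_or_ge l (j + 1) with hl | hl
        · simp [Nat.choose_eq_zero_of_lt hl]
        · rw [show l - j = l - (j + 1) + 1 by omega, pow_succ]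
          ring
      rw [← mul_assoc (c : ℝ), h]
      push_cast
      field_simp
      ring

/-! ### Limits of coefficients of classes -/

/-- The `l`-th coefficients of a representative of the class `x` converge to `a`. -/
def HasCoeffLimit (l : ℕ) (x : (ℕ → ℝ⟦X⟧) ⧸ negligible) (a : ℝ) : Prop :=
  ∃ u : ℕ → ℝ⟦X⟧, negligible.mkQ u = x ∧
    Filter.Tendsto (fun N => coeff l (u N)) Filter.atTop (nhds a)

namespace HasCoeffLimit

variable {l : ℕ} {x y : (ℕ → ℝ⟦X⟧) ⧸ negligible} {a b : ℝ}

lemma add (hx : HasCoeffLimit l x a) (hy : HasCoeffLimit l y b) :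
    HasCoeffLimit l (x + y) (a + b) := by
  obtain ⟨u, rfl, hu⟩ := hx
  obtain ⟨v, rfl, hv⟩ := hy
  exact ⟨u + v, map_add _ _ _, by simpa using hu.add hv⟩

lemma sub (hx : HasCoeffLimit l x a) (hy : HasCoeffLimit l y b) :
    HasCoeffLimit l (x - y) (a - b) := by
  obtain ⟨u, rfl, hu⟩ := hx
  obtain ⟨v, rfl, hv⟩ := hy
  exact ⟨u - v, map_sub _ _ _, by simpa using hu.sub hv⟩

lemma smul (c : ℝ) (hx : HasCoeffLimit l x a) : HasCoeffLimit l (c • x) (c * a) := by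
  obtain ⟨u, rfl, hu⟩ := hx
  exact ⟨c • u, map_smul _ _ _, by simpa using hu.const_mul c⟩

lemma unique (hx : HasCoeffLimit l x a) (hy : HasCoeffLimit l y b) (h : x = y) : a = b := by
  obtain ⟨u, rfl, hu⟩ := hx
  obtain ⟨v, rfl, hv⟩ := hy
  have hmem : u - v ∈ negligible := (Submodule.Quotient.eq negligible).mp h
  have h0 := (mem_negligible.mp hmem l).tendsto_zero
  have h1 : Filter.Tendsto (fun N => coeff l ((u - v) N)) Filter.atTop (nhds (a - b)) := by
    simpa using hu.sub hv
  exact sub_eq_zero.mp (tendsto_nhds_unique h1 h0)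

end HasCoeffLimit

/-- `∑ aᵏ¹⁻¹ bᵏ²⁻¹ cᵏ³⁻¹ dᵏ⁴⁻¹ ζ(k₁, k₂, k₃, k₄)` over the quadruples of weight `l`. -/
noncomputable def weightedQuadSum (l a b c d : ℕ) : ℝ :=
  ∑ k ∈ quadIndices l, (a : ℝ) ^ (k 0 - 1) * (b : ℝ) ^ (k 1 - 1) * (c : ℝ) ^ (k 2 - 1) *
    (d : ℝ) ^ (k 3 - 1) * multipleZeta k

/-- The subtracted series carries the weight 0^(k₁-1), which is 1 for k₁ = 1 and 0 for k₁ ≥ 2. It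
thus removes exactly the terms k₁ = 1 and leaves the convergent ones untouched. -/
lemma hasCoeffLimit_genDiff (l a b c d : ℕ) :
    HasCoeffLimit l (genDiff a [b, c, d]) (weightedQuadSum l a b c d) := by
  refine ⟨truncGen [a, b, c, d] - truncGen [0, b, c, d], map_sub _ _ _, ?_⟩
  have hcoeff : ∀ (a N : ℕ), coeff l (truncGen [a, b, c, d] N) =
      ∑ k ∈ Finset.Nat.antidiagonalTuple 4 l,
        (∏ i, if k i = 0 then 0 else ((![a, b, c, d] i : ℕ) : ℝ) ^ (k i - 1)) * truncZeta 4 k N := by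
    intro a N
    rw [← coeff_truncGen]
    simp
  have h : ∀ N, coeff l ((truncGen [a, b, c, d] - truncGen [0, b, c, d]) N) =
      ∑ k ∈ quadIndices l, (a : ℝ) ^ (k 0 - 1) * (b : ℝ) ^ (k 1 - 1) * (c : ℝ) ^ (k 2 - 1) *
        (d : ℝ) ^ (k 3 - 1) * truncZeta 4 k N := by
    intro N
    rw [Pi.sub_apply, map_sub, hcoeff, hcoeff, ← Finset.sum_sub_distrib, quadIndices,
      Finset.sum_filter]
    refine Finset.sum_congr rfl fun k _ => ?_
    by_cases hq : 2 ≤ k 0 ∧ ∀ i, 1 ≤ k i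
    · have hne : ∀ i, k i ≠ 0 := fun i => Nat.one_le_iff_ne_zero.mp (hq.2 i)
      have h0 : k 0 - 1 ≠ 0 := by omega
      rw [if_pos hq]
      simp [Fin.prod_univ_four, hne, zero_pow h0]
    · rw [if_neg hq, sub_eq_zero]
      by_cases hz : ∃ i, k i = 0
      · obtain ⟨i, hi⟩ := hz
        have hp : ∀ v : Fin 4 → ℕ,
            (∏ i, if k i = 0 then (0 : ℝ) else (v i : ℝ) ^ (k i - 1)) = 0 :=
          fun v => Finset.prod_eq_zero (Finset.mem_univ i) (by simp [hi])
        rw [hp, hp]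
      · push Not at hz
        have h0 : k 0 = 1 := by
          have h1 := hz 0
          by_contra h2
          exact hq ⟨by omega, fun i => Nat.one_le_iff_ne_zero.mpr (hz i)⟩
        simp [Fin.prod_univ_four, h0]
  simp_rw [h]
  refine tendsto_finsetSum _ fun k hk => ?_
  rw [quadIndices, Finset.mem_filter] at hk
  exact (tendsto_truncZeta hk.2.1 hk.2.2).const_mul _

lemma hasCoeffLimit_depth_one {l j : ℕ} (hl : 2 ≤ l) (c : ℕ) :
    HasCoeffLimit l (negligible.mkQ (cumul (letter c ^ (j + 1)) 1))
      (((l - 1).choose j : ℝ) * (c : ℝ) ^ (l - 1 - j) * ∑' m : ℕ, 1 / ((m + 1 : ℕ) : ℝ) ^ l) := by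
  refine ⟨_, rfl, ?_⟩
  have hs : Summable fun m : ℕ => 1 / ((m + 1 : ℕ) : ℝ) ^ l :=
    (summable_nat_add_iff 1).mpr (Real.summable_one_div_nat_pow.mpr hl)
  refine (hs.hasSum.tendsto_sum_nat.const_mul
    (((l - 1).choose j : ℝ) * (c : ℝ) ^ (l - 1 - j))).congr fun N => ?_
  obtain ⟨p, rfl⟩ : ∃ p, l = p + 1 := ⟨l - 1, by omega⟩
  rw [cumul, map_sum, Finset.mul_sum]
  refine Finset.sum_congr rfl fun m _ => ?_
  rw [Pi.pow_apply, Pi.one_apply, mul_one, coeff_letter_pow_succ c (Nat.succ_ne_zero m)]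
  simp

lemma hasCoeffLimit_letter_one_pow {l : ℕ} (hl : 2 ≤ l) (j : ℕ) :
    HasCoeffLimit l (negligible.mkQ (cumul (letter 1 ^ (j + 1)) 1))
      (((l - 1).choose j : ℝ) * ∑' m : ℕ, 1 / ((m + 1 : ℕ) : ℝ) ^ l) := by
  simpa using hasCoeffLimit_depth_one (j := j) hl 1

/-- Since `letter 0 m` = X/m, this power lives in degree j + 1 alone. Exponents up to 4 occur, which
is where l ≥ 5 enters. -/
lemma hasCoeffLimit_letter_zero_pow {l j : ℕ} (hl : 2 ≤ l) (hj : j + 1 < l) :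
    HasCoeffLimit l (negligible.mkQ (cumul (letter 0 ^ (j + 1)) 1)) 0 := by
  have h := hasCoeffLimit_depth_one (j := j) hl 0
  rwa [Nat.cast_zero, zero_pow (by omega), mul_zero, zero_mul] at h

lemma riemannZeta_eq_ofReal_tsum {l : ℕ} (hl : 2 ≤ l) :
    riemannZeta l = ((∑' m : ℕ, 1 / ((m + 1 : ℕ) : ℝ) ^ l : ℝ) : ℂ) := by
  rw [zeta_nat_eq_tsum_of_gt_one (by omega)]
  have hs : Summable fun m : ℕ => 1 / (m : ℝ) ^ l := Real.summable_one_div_nat_pow.mpr hl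
  have h := hs.tsum_eq_zero_add
  rw [Nat.cast_zero, zero_pow (by omega), div_zero, zero_add] at h
  rw [← h]
  push_cast
  rfl

/-! ### The weighted sum formulas -/

lemma weightedQuadSum_depths_one_three {l : ℕ} (hl : 5 ≤ l) :
    2 * weightedQuadSum l 2 2 2 1 + weightedQuadSum l 2 2 1 1 + weightedQuadSum l 2 1 1 1
      - 2 * weightedQuadSum l 1 2 2 1 - weightedQuadSum l 1 2 1 1 =
      l * ∑' m : ℕ, 1 / ((m + 1 : ℕ) : ℝ) ^ l := by
  have hL := (((((hasCoeffLimit_genDiff l 2 2 2 1).smul 2).add (hasCoeffLimit_genDiff l 2 2 1 1)).add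
    (hasCoeffLimit_genDiff l 2 1 1 1)).sub ((hasCoeffLimit_genDiff l 1 2 2 1).smul 2)).sub
    (hasCoeffLimit_genDiff l 1 2 1 1)
  have h1 := hasCoeffLimit_letter_one_pow (l := l) (by omega)
  have h0 (j : ℕ) (hj : j < 4) := hasCoeffLimit_letter_zero_pow (l := l) (j := j) (by omega) (by omega)
  have hR := (((((h1 0).add (h1 1)).sub (h0 0 (by omega))).sub ((h0 1 (by omega)).smul 2)).sub
    ((h0 2 (by omega)).smul 3)).sub ((h0 3 (by omega)).smul 4)
  rw [hL.unique hR genDiff_relation_depths_one_three, Nat.choose_zero_right, Nat.choose_one_right,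
    Nat.cast_sub (by omega : 1 ≤ l)]
  push_cast
  ring

lemma weightedQuadSum_depths_two_two {l : ℕ} (hl : 5 ≤ l) :
    4 * weightedQuadSum l 2 2 2 1 + 2 * weightedQuadSum l 2 2 1 1 - 4 * weightedQuadSum l 1 2 2 1
      - 2 * weightedQuadSum l 1 2 1 1 - 4 * weightedQuadSum l 1 1 2 1 =
      (l - 3) * ∑' m : ℕ, 1 / ((m + 1 : ℕ) : ℝ) ^ l := by
  have hL := (((((hasCoeffLimit_genDiff l 2 2 2 1).smul 4).add
    ((hasCoeffLimit_genDiff l 2 2 1 1).smul 2)).sub ((hasCoeffLimit_genDiff l 1 2 2 1).smul 4)).sub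
    ((hasCoeffLimit_genDiff l 1 2 1 1).smul 2)).sub ((hasCoeffLimit_genDiff l 1 1 2 1).smul 4)
  have h1 := hasCoeffLimit_letter_one_pow (l := l) (by omega)
  have h0 (j : ℕ) (hj : j < 4) := hasCoeffLimit_letter_zero_pow (l := l) (j := j) (by omega) (by omega)
  have hR := (((((h1 0).smul (-2)).add (h1 1)).add ((h0 0 (by omega)).smul 2)).add
    (h0 1 (by omega))).sub (h0 3 (by omega))
  rw [hL.unique hR genDiff_relation_depths_two_two, Nat.choose_zero_right, Nat.choose_one_right,
    Nat.cast_sub (by omega : 1 ≤ l)]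
  push_cast
  ring

lemma weightedQuadSum_depths_one_one_two {l : ℕ} (hl : 5 ≤ l) :
    12 * weightedQuadSum l 4 3 2 1 - 12 * weightedQuadSum l 2 3 2 1
      - 4 * weightedQuadSum l 2 1 2 1 =
      (l + 1) * (l ^ 2 + 5 * l - 18) / 12 * ∑' m : ℕ, 1 / ((m + 1 : ℕ) : ℝ) ^ l := by
  have hL := (((hasCoeffLimit_genDiff l 4 3 2 1).smul 12).sub
    ((hasCoeffLimit_genDiff l 2 3 2 1).smul 12)).sub ((hasCoeffLimit_genDiff l 2 1 2 1).smul 4)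
  have h1 := hasCoeffLimit_letter_one_pow (l := l) (by omega)
  have h0 (j : ℕ) (hj : j < 4) := hasCoeffLimit_letter_zero_pow (l := l) (j := j) (by omega) (by omega)
  have hR := ((((((((h1 0).smul (-2)).add (h1 1)).add ((h1 2).smul 2)).add
    ((h1 3).smul (1 / 2))).add ((h0 0 (by omega)).smul 2)).add (h0 1 (by omega))).sub
    ((h0 2 (by omega)).smul 2)).sub ((h0 3 (by omega)).smul (15 / 2))
  have hc3 : ((l - 1).choose 3 : ℝ) = ((l : ℝ) - 1) * (l - 2) * (l - 3) / 6 := by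
    have h := Nat.choose_succ_right_eq (l - 1) 2
    have h' : ((l - 1).choose 3 : ℝ) * 3 = ((l - 1).choose 2 : ℝ) * ((l - 1 - 2 : ℕ) : ℝ) := by
      exact_mod_cast h
    rw [Nat.cast_choose_two, Nat.cast_sub (by omega : 2 ≤ l - 1),
      Nat.cast_sub (by omega : 1 ≤ l)] at h'
    push_cast at h'
    linarith
  rw [hL.unique hR genDiff_relation_depths_one_one_two, hc3, Nat.cast_choose_two, Nat.choose_zero_right,
    Nat.choose_one_right, Nat.cast_sub (by omega : 1 ≤ l)]
  push_cast
  ring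

/-- This substitution removes truncated subtraction from the exponents, so that `ring` can compare
the weights. -/
lemma exists_eq_add_of_mem_quadIndices {l : ℕ} {k : Fin 4 → ℕ} (hk : k ∈ quadIndices l) :
    ∃ p q r s, k 0 = p + 2 ∧ k 1 = q + 1 ∧ k 2 = r + 1 ∧ k 3 = s + 1 := by
  rw [quadIndices, Finset.mem_filter] at hk
  obtain ⟨-, h0, h⟩ := hk
  exact ⟨k 0 - 2, k 1 - 1, k 2 - 1, k 3 - 1, by omega, by have := h 1; omega,
    by have := h 2; omega, by have := h 3; omega⟩

theorem theorem2 (l : ℕ) (hl : 5 ≤ l) :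
    -- all the defining series occurring below converge
    (∀ k ∈ quadIndices l, Summable (mzvTerm k)) ∧
    -- (i)
    (((∑ k ∈ quadIndices l,
        ((2 : ℝ) ^ (k 0 + k 1 + k 2 - 2) + 2 ^ (k 0 + k 1 - 2) + 2 ^ (k 0 - 1)
          - 2 ^ (k 1 + k 2 - 1) - 2 ^ (k 1 - 1)) * multipleZeta k : ℝ) : ℂ)
      = (l : ℂ) * riemannZeta (l : ℂ)) ∧
    (((∑ k ∈ quadIndices l,
        ((2 : ℝ) ^ (k 0 + k 1 + k 2 - 1) + 2 ^ (k 0 + k 1 - 1) - 2 ^ (k 1 + k 2)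
          - 2 ^ k 1 - 2 ^ (k 2 + 1)) * multipleZeta k : ℝ) : ℂ)
      = ((l : ℂ) - 3) * riemannZeta (l : ℂ)) ∧
    (((∑ k ∈ quadIndices l,
        ((2 : ℝ) ^ k 0 + 2 ^ (k 2 + 1)) * multipleZeta k : ℝ) : ℂ)
      = ((l : ℂ) + 3) * riemannZeta (l : ℂ)) ∧
    -- (ii)
    (((∑ k ∈ quadIndices l,
        ((3 : ℝ) ^ k 1 * 2 ^ (k 0 - 1) - 3 ^ k 1 - 1) * 2 ^ (k 0 + k 2)
          * multipleZeta k : ℝ) : ℂ)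
      = ((l : ℂ) + 1) * ((l : ℂ) ^ 2 + 5 * (l : ℂ) - 18) / 12 * riemannZeta (l : ℂ)) := by
  have hF := weightedQuadSum_depths_one_three hl
  have hS := weightedQuadSum_depths_two_two hl
  have hT := weightedQuadSum_depths_one_one_two hl
  have key : ∀ (f : (Fin 4 → ℕ) → ℝ) (A c : ℝ),
      A = c * ∑' m : ℕ, 1 / ((m + 1 : ℕ) : ℝ) ^ l →
      ∑ k ∈ quadIndices l, f k * multipleZeta k = A →
      ((∑ k ∈ quadIndices l, f k * multipleZeta k : ℝ) : ℂ) = (c : ℂ) * riemannZeta (l : ℂ) := by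
    intro f A c hA hf
    rw [hf, hA, riemannZeta_eq_ofReal_tsum (by omega), Complex.ofReal_mul]
  refine ⟨fun k hk => ?_, ?_, ?_, ?_, ?_⟩
  · rw [quadIndices, Finset.mem_filter] at hk
    exact summable_mzvTerm hk.2.1 hk.2.2
  · have h := key (fun k => (2 : ℝ) ^ (k 0 + k 1 + k 2 - 2) + 2 ^ (k 0 + k 1 - 2) + 2 ^ (k 0 - 1)
      - 2 ^ (k 1 + k 2 - 1) - 2 ^ (k 1 - 1)) _ _ hF ?_
    · simpa using h
    · simp only [weightedQuadSum, Finset.mul_sum, ← Finset.sum_add_distrib,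
        ← Finset.sum_sub_distrib]
      refine Finset.sum_congr rfl fun k hk => ?_
      obtain ⟨p, q, r, s, h0, h1, h2, h3⟩ := exists_eq_add_of_mem_quadIndices hk
      rw [h0, h1, h2, h3, show p + 2 + (q + 1) + (r + 1) - 2 = p + q + r + 2 by omega,
        show p + 2 + (q + 1) - 2 = p + q + 1 by omega, show p + 2 - 1 = p + 1 by omega,
        show q + 1 + (r + 1) - 1 = q + r + 1 by omega]
      simp only [Nat.add_sub_cancel, Nat.cast_one, one_pow, Nat.cast_ofNat]
      ring
  · have h := key (fun k => (2 : ℝ) ^ (k 0 + k 1 + k 2 - 1) + 2 ^ (k 0 + k 1 - 1) - 2 ^ (k 1 + k 2)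
      - 2 ^ k 1 - 2 ^ (k 2 + 1)) _ _ hS ?_
    · simpa using h
    · simp only [weightedQuadSum, Finset.mul_sum, ← Finset.sum_add_distrib,
        ← Finset.sum_sub_distrib]
      refine Finset.sum_congr rfl fun k hk => ?_
      obtain ⟨p, q, r, s, h0, h1, h2, h3⟩ := exists_eq_add_of_mem_quadIndices hk
      rw [h0, h1, h2, h3, show p + 2 + (q + 1) + (r + 1) - 1 = p + q + r + 3 by omega,
        show p + 2 + (q + 1) - 1 = p + q + 2 by omega, show p + 2 - 1 = p + 1 by omega]
      simp only [Nat.add_sub_cancel, Nat.cast_one, one_pow, Nat.cast_ofNat]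
      ring
  -- Twice the first identity minus the second: 2l - (l - 3) = l + 3.
  · have h := key (fun k => (2 : ℝ) ^ k 0 + 2 ^ (k 2 + 1))
      (2 * weightedQuadSum l 2 1 1 1 + 4 * weightedQuadSum l 1 1 2 1) (l + 3)
      (by linear_combination 2 * hF - hS) ?_
    · simpa using h
    · simp only [weightedQuadSum, Finset.mul_sum, ← Finset.sum_add_distrib]
      refine Finset.sum_congr rfl fun k hk => ?_
      obtain ⟨p, q, r, s, h0, h1, h2, h3⟩ := exists_eq_add_of_mem_quadIndices hk
      rw [h0, h1, h2, h3, show p + 2 - 1 = p + 1 by omega]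
      simp only [Nat.add_sub_cancel, Nat.cast_one, one_pow, Nat.cast_ofNat]
      ring
  · have h := key (fun k => ((3 : ℝ) ^ k 1 * 2 ^ (k 0 - 1) - 3 ^ k 1 - 1) * 2 ^ (k 0 + k 2))
      _ _ hT ?_
    · simpa using h
    · simp only [weightedQuadSum, Finset.mul_sum, ← Finset.sum_sub_distrib]
      refine Finset.sum_congr rfl fun k hk => ?_
      obtain ⟨p, q, r, s, h0, h1, h2, h3⟩ := exists_eq_add_of_mem_quadIndices hk
      rw [h0, h1, h2, h3, show p + 2 - 1 = p + 1 by omega]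
      simp only [Nat.add_sub_cancel, Nat.cast_one, one_pow, Nat.cast_ofNat]
      rw [show (4 : ℝ) = 2 ^ 2 by norm_num, ← pow_mul]
      ring
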